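/- Consider the control-affine plant $$\dot x=f(x)+B(x)u+B_w(x)w,\qquad z=g(x,u),$$ with $x(t)\in\mathbb R^n$, $u(t)\in\mathbb R^m$, $w(t)\in\mathbb R^p$, $z(t)\in\mathbb R^q$ and $f,B,B_w,g$ continuously differentiable. Let $b_i$, $b_{w,i}$ be the columns of $B$, $B_w$, and put $$A(x,u,w)=\frac{\partial f}{\partial x}+\sum_{i=1}^m\frac{\partial b_i}{\partial x}u_i+\sum_{i=1}^p\frac{\partial b_{w,i}}{\partial x}w_i,\qquad C(x,u)=\frac{\partial g}{\partial x},\qquad D(x,u)=\frac{\partial g}{\partial u}.$$ Let $W$ be a smooth function on $\mathbb R^n$ with symmetric positive definite $n\times n$ values that is uniformly bounded, i.e. $a_1I\le W(x)\le a_2I$ for all $x$ and some constants $a_2\ge a_1>0$; let $Y:\mathbb R^n\to\mathbb R^{m\times n}$ be continuous, and let $\lambda,\mu,\alpha>0$ be constants such that for all $x,u,w$ $$\begin{bmatrix}\langle AW+BY\rangle-\dot W+\lambda W&B_w\\ B_w^\top&-\mu I_p\end{bmatrix}\le 0,\qquad \begin{bmatrix}\lambda W&0&(CW+DY)^\top\\0&(\alpha-\mu)I_p&0\\CW+DY&0&\alpha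 I_q\end{bmatrix}\ge 0,$$ where $\langle X\rangle=X+X^\top$ and $\dot W=\sum_{i=1}^n\frac{\partial W}{\partial x_i}\dot x_i$ with $\dot x=f(x)+B(x)u+B_w(x)w$. Let $M=W^{-1}$ and $K=YW^{-1}$. For $a,b\in\mathbb R^n$ let $\Gamma(a,b)$ be the set of piecewise smooth paths $c:[0,1]\to\mathbb R^n$ with $c(0)=a$, $c(1)=b$; let $E(c)=\int_0^1c_s^\top M(c)c_s\,ds$ and $E(a,b)=\inf_{c\in\Gamma(a,b)}E(c)$. Given a target trajectory $(x^\star,u^\star,w^\star)$, i.e. a solution of the plant equation on $[0,\infty)$, with output $z^\star=g(x^\star,u^\star)$, consider the controller $$u(t)=u^\star(t)+\int_0^1K(\gamma(t,s))\frac{\partial\gamma(t,s)}{\partial s}\,ds,\qquad \gamma(t,\cdot)\in\operatorname*{arg\,min}_{c\in\Gamma(x^\star(t),x(t))}E(c).$$ Then for every target trajectory and every trajectory $(x,u,w)$ on $[0,\infty)$ of the closed-loop system (with any initial state $x(0)$) such that $w-w^\star$ is bounded on every bounded interval and such that the set of times $t\ge 0$ at which $x(t)$ lies in the cut locus of $x^\star(t)$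 for the Riemannian metric $M$ has measure zero, the output $z=g(x,u)$ satisfies $$\sup_{0\le t\le T}\|z(t)-z^\star(t)\|^2\le\alpha^2\sup_{0\le t\le T}\|w(t)-w^\star(t)\|^2+\beta(x(0),x^\star(0))\qquad\text{for all }T>0,$$ where $\beta(x,x^\star)=\alpha\lambda E(x,x^\star)$, which satisfies $\beta\ge 0$ and $\beta(x,x)=0$; that is, the controller achieves the universal $\mathcal L_\infty$-gain bound $\alpha$. In particular, if moreover $x(0)=x^\star(0)$ and $\|w(t)-w^\star(t)\|\le\bar w$ for $0\le t\le T$, then $\|z(t)-z^\star(t)\|\le\alpha\bar w$ for $0\le t\le T$. -/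

import Mathlib

open scoped Matrix ContDiff ENNReal

noncomputable section

namespace RCCM

/-- `ℝᵏ` with its Euclidean norm. -/
abbrev E (k : ℕ) : Type := EuclideanSpace ℝ (Fin k)

/-- Matrix times vector, as a map between Euclidean spaces. -/
def app {k l : ℕ} (A : Matrix (Fin k) (Fin l) ℝ) (v : E l) : E k :=
  WithLp.toLp 2 (A *ᵥ v.ofLp)

/-- The bilinear form `aᵀ A b`. -/
def form {k l : ℕ} (A : Matrix (Fin k) (Fin l) ℝ) (a : E k) (b : E l) : ℝ :=
  a.ofLp ⬝ᵥ (A *ᵥ b.ofLp)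

/-- The Jacobian matrix of `h` at `x`. -/
def jac {k l : ℕ} (h : E k → E l) (x : E k) : Matrix (Fin l) (Fin k) ℝ :=
  Matrix.of fun i j => fderiv ℝ h x (EuclideanSpace.single j 1) i

/-- The directional derivative `∑ᵢ (∂F/∂xᵢ) vᵢ` of a matrix function, entry by entry. -/
def matDeriv {d k l : ℕ} (F : E d → Matrix (Fin k) (Fin l) ℝ) (x v : E d) :
    Matrix (Fin k) (Fin l) ℝ :=
  Matrix.of fun i j => fderiv ℝ (fun y => F y i j) x v

/-! ### The plant -/

/-- The data of the control-affine plant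
`ẋ = f(x) + B(x) u + B_w(x) w`, `z = g(x, u)`. -/
structure Plant (n m p q : ℕ) where
  f : E n → E n
  B : E n → Matrix (Fin n) (Fin m) ℝ
  Bw : E n → Matrix (Fin n) (Fin p) ℝ
  g : E n → E m → E q

variable {n m p q : ℕ}

namespace Plant

/-- The data of the plant are continuously differentiable. -/
structure IsC1 (P : Plant n m p q) : Prop where
  f : ContDiff ℝ 1 P.f
  B : ∀ i j, ContDiff ℝ 1 fun x => P.B x i j
  Bw : ∀ i j, ContDiff ℝ 1 fun x => P.Bw x i j
  g : ContDiff ℝ 1 fun a : E n × E m => P.g a.1 a.2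

/-- The right-hand side `f(x) + B(x) u + B_w(x) w`. -/
def rhs (P : Plant n m p q) (x : E n) (u : E m) (w : E p) : E n :=
  P.f x + app (P.B x) u + app (P.Bw x) w

/-- `A(x,u,w) = ∂f/∂x + ∑ᵢ (∂bᵢ/∂x) uᵢ + ∑ᵢ (∂b_{w,i}/∂x) wᵢ`, where `bᵢ` and `b_{w,i}` are the
columns of `B` and `B_w`. -/
def A (P : Plant n m p q) (x : E n) (u : E m) (w : E p) : Matrix (Fin n) (Fin n) ℝ :=
  jac P.f x
    + ∑ i, u i • jac (fun y => WithLp.toLp 2 fun k => P.B y k i) x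
    + ∑ i, w i • jac (fun y => WithLp.toLp 2 fun k => P.Bw y k i) x

/-- `C(x,u) = ∂g/∂x`. -/
def C (P : Plant n m p q) (x : E n) (u : E m) : Matrix (Fin q) (Fin n) ℝ :=
  jac (fun y => P.g y u) x

/-- `D(x,u) = ∂g/∂u`. -/
def D (P : Plant n m p q) (x : E n) (u : E m) : Matrix (Fin q) (Fin m) ℝ :=
  jac (fun v => P.g x v) u

end Plant

/-! ### Metrics, paths, energy, geodesics and the cut locus -/

/-- A uniformly bounded metric on `ℝⁿ`: a smooth function with symmetric positive definite values
such that `a₁ I ≤ W(x) ≤ a₂ I` for all `x`, with constants `a₂ ≥ a₁ > 0`. -/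
structure IsUniformlyBoundedMetric (W : E n → Matrix (Fin n) (Fin n) ℝ) : Prop where
  smooth : ∀ i j, ContDiff ℝ ∞ fun x => W x i j
  posDef : ∀ x, (W x).PosDef
  bounded : ∃ a₁ a₂ : ℝ, 0 < a₁ ∧ a₁ ≤ a₂ ∧
    ∀ x, (W x - a₁ • (1 : Matrix (Fin n) (Fin n) ℝ)).PosSemidef ∧
      (a₂ • (1 : Matrix (Fin n) (Fin n) ℝ) - W x).PosSemidef

/-- `Γ(a, b)`: piecewise smooth paths `c : [0,1] → ℝⁿ` with `c 0 = a`, `c 1 = b`. The path is smooth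
on each of the closed intervals `[τ i, τ (i+1)]`, so it is continuous on `[0,1]`. Values outside
`[0,1]` play no role. -/
def Paths (a b : E n) : Set (ℝ → E n) :=
  {c | c 0 = a ∧ c 1 = b ∧ ∃ (N : ℕ) (τ : ℕ → ℝ), Monotone τ ∧ τ 0 = 0 ∧ τ N = 1 ∧
    ∀ i < N, ContDiffOn ℝ ∞ c (Set.Icc (τ i) (τ (i + 1)))}

/-- The energy `∫₀¹ c_sᵀ M(c) c_s ds` of a path. -/
def energy (M : E n → Matrix (Fin n) (Fin n) ℝ) (c : ℝ → E n) : ℝ :=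
  ∫ s in (0 : ℝ)..1, form (M (c s)) (deriv c s) (deriv c s)

/-- The minimal energy `E(a, b) = inf {E(c) : c ∈ Γ(a, b)}`. -/
def minEnergy (M : E n → Matrix (Fin n) (Fin n) ℝ) (a b : E n) : ℝ :=
  sInf (energy M '' Paths a b)

/-- `c` is a path of minimal energy from `a` to `b`. -/
def IsMinimalPath (M : E n → Matrix (Fin n) (Fin n) ℝ) (a b : E n) (c : ℝ → E n) : Prop :=
  c ∈ Paths a b ∧ ∀ c' ∈ Paths a b, energy M c ≤ energy M c'

/-- The Riemannian length of a path. -/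
def length (M : E n → Matrix (Fin n) (Fin n) ℝ) (c : ℝ → E n) : ℝ :=
  ∫ s in (0 : ℝ)..1, √(form (M (c s)) (deriv c s) (deriv c s))

/-- The Riemannian distance. -/
def riemannianDist (M : E n → Matrix (Fin n) (Fin n) ℝ) (a b : E n) : ℝ :=
  sInf (length M '' Paths a b)

/-- `γ` is a geodesic of `M`: it satisfies the geodesic equation, written with lowered index,
`d/ds (M(γ) γ') = ½ (∂/∂x) (γ'ᵀ M(x) γ')` at `x = γ`, tested against each vector `v`. -/
def IsGeodesic (M : E n → Matrix (Fin n) (Fin n) ℝ) (γ : ℝ → E n) : Prop :=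
  ContDiff ℝ ∞ γ ∧ ∀ (v : E n) (s : ℝ),
    HasDerivAt (fun r => form (M (γ r)) v (deriv γ r))
      (1 / 2 * form (matDeriv M (γ s) v) (deriv γ s) (deriv γ s)) s

/-- The cut locus of `a` for a complete metric `M`: the points `γ(s₀)`, where `γ` is a unit-speed
geodesic issuing from `a` and `s₀ > 0` is the last parameter up to which `γ` is minimizing. -/
def cutLocus (M : E n → Matrix (Fin n) (Fin n) ℝ) (a : E n) : Set (E n) :=
  {b | ∃ (γ : ℝ → E n) (s₀ : ℝ), IsGeodesic M γ ∧ γ 0 = a ∧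
    (∀ s, form (M (γ s)) (deriv γ s) (deriv γ s) = 1) ∧
    0 < s₀ ∧ IsGreatest {s : ℝ | 0 ≤ s ∧ riemannianDist M a (γ s) = s} s₀ ∧ γ s₀ = b}

/-! ### Trajectories and closed loops -/

/-- A triple of state, input and disturbance signals; only times `t ≥ 0` matter. -/
structure Signals (n m p : ℕ) where
  x : ℝ → E n
  u : ℝ → E m
  w : ℝ → E p

/-- The signals satisfy `ẋ = f(x) + B(x) u + B_w(x) w` on `[0, ∞)` in the sense of Carathéodory:
`x` is locally absolutely continuous and the equation holds at almost every time. -/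
def Plant.IsTrajectory (P : Plant n m p q) (σ : Signals n m p) : Prop :=
  (∀ T > 0, AbsolutelyContinuousOnInterval σ.x 0 T) ∧
    ∀ᵐ t ∂(MeasureTheory.volume.restrict (Set.Ici (0 : ℝ))),
      HasDerivAt σ.x (P.rhs (σ.x t) (σ.u t) (σ.w t)) t

/-- The output signal `z = g(x, u)`. -/
def Plant.output (P : Plant n m p q) (σ : Signals n m p) (t : ℝ) : E q :=
  P.g (σ.x t) (σ.u t)

/-- `σ` is a trajectory of the closed loop of the plant with the controller
`u(t) = k(x(t), x⋆(t)) + u⋆(t)`, where `⋆` refers to the target `σs`. The feedback law may be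
multivalued: `k x x⋆` is the set of admissible feedback values. -/
def Plant.IsClosedLoop (P : Plant n m p q) (k : E n → E n → Set (E m))
    (σs σ : Signals n m p) : Prop :=
  P.IsTrajectory σ ∧ ∀ t ≥ 0, ∃ v ∈ k (σ.x t) (σs.x t), σ.u t = v + σs.u t

/-- The feedback term of the robust control contraction metric controller with metric `M` and gain
`K`: the values `∫₀¹ K(γ(s)) γ_s(s) ds`, where `γ` is a path of minimal energy joining
`γ(0) = x⋆` to `γ(1) = x`. -/
def rccmLaw (M : E n → Matrix (Fin n) (Fin n) ℝ) (K : E n → Matrix (Fin m) (Fin n) ℝ)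
    (x xs : E n) : Set (E m) :=
  {v | ∃ γ : ℝ → E n, IsMinimalPath M xs x γ ∧
    v = ∫ s in (0 : ℝ)..1, app (K (γ s)) (deriv γ s)}

/-- The set of times `t ≥ 0` at which `x(t)` is in the cut locus of `x⋆(t)` has measure zero. -/
def AvoidsCutLocus (M : E n → Matrix (Fin n) (Fin n) ℝ) (σs σ : Signals n m p) : Prop :=
  MeasureTheory.volume {t : ℝ | 0 ≤ t ∧ σ.x t ∈ cutLocus M (σs.x t)} = 0

/-- The pairs (target, response) of the closed loop of the plant with the controller built from `W`
and `Y`, that is, with metric `M = W⁻¹` and gain `K = Y W⁻¹`, which satisfy the cut-locus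
assumption. -/
def rccmLoop (P : Plant n m p q) (W : E n → Matrix (Fin n) (Fin n) ℝ)
    (Y : E n → Matrix (Fin m) (Fin n) ℝ) (σs σ : Signals n m p) : Prop :=
  P.IsClosedLoop (rccmLaw (fun x => (W x)⁻¹) (fun x => Y x * (W x)⁻¹)) σs σ ∧
    AvoidsCutLocus (fun x => (W x)⁻¹) σs σ

/-! ### The universal `L∞` gain -/

/-- The truncated norm `sup_{0 ≤ t ≤ T} ‖y(t)‖`, as an extended nonnegative real. -/
def truncNorm {k : ℕ} (T : ℝ) (y : ℝ → E k) : ℝ≥0∞ :=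
  ⨆ t ∈ Set.Icc 0 T, ‖y t‖ₑ

/-- `y ∈ L∞e`: the amplitude of `y` is finite on every finite interval `[a, b]` of times `≥ 0`. -/
def MemLinfE {k : ℕ} (y : ℝ → E k) : Prop :=
  ∀ a b : ℝ, 0 ≤ a → (⨆ t ∈ Set.Icc a b, ‖y t‖ₑ) < ⊤

/-- The closed-loop system whose pairs (target, response) are described by `S` achieves the
universal `L∞`-gain bound `α` with offset `β`: `β ≥ 0`, `β(a, a) = 0`, and for every target
trajectory `σs` of the plant and every response `σ` to it with `w - w⋆ ∈ L∞e`,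
`‖z - z⋆‖²_[0,T] ≤ α² ‖w - w⋆‖²_[0,T] + β(x(0), x⋆(0))` for all `T > 0`. -/
def AchievesUniversalLinfGain (P : Plant n m p q)
    (S : Signals n m p → Signals n m p → Prop) (α : ℝ) (β : E n → E n → ℝ) : Prop :=
  (∀ a b, 0 ≤ β a b) ∧ (∀ a, β a a = 0) ∧
    ∀ σs σ : Signals n m p, P.IsTrajectory σs → S σs σ →
      MemLinfE (fun t => σ.w t - σs.w t) →
      ∀ T > 0,
        truncNorm T (fun t => P.output σ t - P.output σs t) ^ 2 ≤
          ENNReal.ofReal α ^ 2 * truncNorm T (fun t => σ.w t - σs.w t) ^ 2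
            + ENNReal.ofReal (β (σ.x 0) (σs.x 0))

/-- The tubes certified by a gain bound `α`: if the response starts at the target state and the
disturbance deviates by at most `wbar` on `[0, T]`, the output stays within `α wbar` of the target
output on `[0, T]`. -/
def CertifiesTubes (P : Plant n m p q)
    (S : Signals n m p → Signals n m p → Prop) (α : ℝ) : Prop :=
  ∀ σs σ : Signals n m p, P.IsTrajectory σs → S σs σ →
    MemLinfE (fun t => σ.w t - σs.w t) → σ.x 0 = σs.x 0 →
    ∀ T > 0, ∀ wbar : ℝ, (∀ t ∈ Set.Icc 0 T, ‖σ.w t - σs.w t‖ ≤ wbar) →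
      ∀ t ∈ Set.Icc 0 T, ‖P.output σ t - P.output σs t‖ ≤ α * wbar

/-! ### The synthesis conditions -/

/-- The matrix
`[⟨A W + B Y⟩ - Ẇ + lam W, B_w; B_wᵀ, -μ I]` at `(x, u, w)`, where `⟨X⟩ = X + Xᵀ` and
`Ẇ = ∑ᵢ (∂W/∂xᵢ) ẋᵢ` along the plant. -/
def lmi₁ (P : Plant n m p q) (W : E n → Matrix (Fin n) (Fin n) ℝ)
    (Y : E n → Matrix (Fin m) (Fin n) ℝ) (lam μ : ℝ) (x : E n) (u : E m) (w : E p) :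
    Matrix (Fin n ⊕ Fin p) (Fin n ⊕ Fin p) ℝ :=
  Matrix.fromBlocks
    ((P.A x u w * W x + P.B x * Y x) + (P.A x u w * W x + P.B x * Y x)ᵀ
      - matDeriv W x (P.rhs x u w) + lam • W x)
    (P.Bw x)
    (P.Bw x)ᵀ
    (-(μ • (1 : Matrix (Fin p) (Fin p) ℝ)))

/-- The symmetric matrix
`[lam W, 0, (C W + D Y)ᵀ; 0, (α - μ) I, 0; C W + D Y, 0, α I]` at `(x, u)`. -/
def lmi₂ (P : Plant n m p q) (W : E n → Matrix (Fin n) (Fin n) ℝ)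
    (Y : E n → Matrix (Fin m) (Fin n) ℝ) (lam μ α : ℝ) (x : E n) (u : E m) :
    Matrix ((Fin n ⊕ Fin p) ⊕ Fin q) ((Fin n ⊕ Fin p) ⊕ Fin q) ℝ :=
  Matrix.fromBlocks
    (Matrix.fromBlocks (lam • W x) 0 0 ((α - μ) • (1 : Matrix (Fin p) (Fin p) ℝ)))
    (Matrix.fromRows (P.C x u * W x + P.D x u * Y x)ᵀ 0)
    (Matrix.fromCols (P.C x u * W x + P.D x u * Y x) 0)
    (α • (1 : Matrix (Fin q) (Fin q) ℝ))

end RCCM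

end

/-! Let `e(t)` be the minimal energy between target and response. The theorem follows from two
estimates along a minimal path `c` from `x⋆` to `x`: `e' ≤ -λ e + μ |w - w⋆|²` almost everywhere,
and `|z - z⋆|² ≤ α λ e` at every time. Grönwall turns the first into `e(t) ≤ e(0) + μ sup |w - w⋆|²
/ λ`, and the second, with `μ ≤ α`, gives the gain bound.

For the first estimate, `e` is absolutely continuous (`absolutelyContinuousOnInterval_minEnergy`):
displacing the ends of a minimal path by `δ` costs `O(δ)` of energy. At a time where `x`, `x⋆` and
`e` are all differentiable, deform `c` along a field `V` whose end values are the two velocities.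
The energy of the deformed path, corrected at its ends by `o(h)`, lies above `e(t + h)` and touches
it at `h = 0`, so the derivatives agree: `e'` is the first variation of the energy along `V`
(`deriv_minEnergy_eq`). It is an equality for every such `V`, and `c` need be neither unique nor a
smooth geodesic.

Now choose `V` to be the plant's velocity along `c`, with the input obtained by integrating `K(c)
c_s` from `u⋆` and the disturbance interpolated linearly. The end values are right precisely because
of the controller. In terms of the momentum `ξ = W⁻¹ c_s`, the integrand of the first variation is
the quadratic form controlled by the first matrix inequality (`deriv_minEnergy_le`).

For the second estimate, the same family of inputs makes `z - z⋆` the integral of `(C + D K) c_s`;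
the second matrix inequality bounds this integral against the energy (`norm_output_sub_sq_le`). -/

noncomputable section

namespace RCCM

open MeasureTheory Set Filter Topology

section

/-! ### Piecewise differentiable curves on the unit interval -/

/-- `c` is continuous on `[0, 1]` and, off the countable set `S`, differentiable with bounded
derivative. -/
structure PiecewiseDiff {G : Type*} [NormedAddCommGroup G] [NormedSpace ℝ G]
    (c : ℝ → G) (S : Set ℝ) : Prop where
  countable : S.Countable
  continuousOn : ContinuousOn c (Icc 0 1)
  hasDerivAt : ∀ s ∈ Ioo (0 : ℝ) 1 \ S, HasDerivAt c (deriv c s) s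
  bounded : ∃ R, ∀ s ∈ Ioo (0 : ℝ) 1 \ S, ‖deriv c s‖ ≤ R

lemma exists_mem_Ico_of_monotone {τ : ℕ → ℝ} {s : ℝ} (h0 : τ 0 ≤ s) :
    ∀ N : ℕ, s < τ N → ∃ i < N, τ i ≤ s ∧ s < τ (i + 1) := by
  intro N
  induction N with
  | zero => intro h; exact absurd h (not_lt.2 h0)
  | succ N ih =>
    intro h
    by_cases hN : s < τ N
    · obtain ⟨i, hi, h1⟩ := ih hN
      exact ⟨i, by omega, h1⟩
    · exact ⟨N, by omega, not_lt.1 hN, h⟩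

/-- The exceptional set is the set of break points `τ i`, and the velocity is bounded because each
piece is smooth up to its closed ends. Continuity of the velocity off `S` is what later makes the
integrated feedback differentiable there. -/
theorem exists_piecewiseDiff_of_mem_paths {n : ℕ} {a b : E n} {c : ℝ → E n} (hc : c ∈ Paths a b) :
    ∃ S, PiecewiseDiff c S ∧ ∀ s ∈ Ioo (0 : ℝ) 1 \ S, ContinuousAt (deriv c) s := by
  obtain ⟨-, -, N, τ, hτ, h0, h1, hsm⟩ := hc
  have hmem : ∀ s ∈ Ioo (0 : ℝ) 1 \ range τ, ∃ i < N, s ∈ Ioo (τ i) (τ (i + 1)) := by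
    rintro s ⟨⟨hs0, hs1⟩, hsS⟩
    obtain ⟨i, hi, hi1, hi2⟩ := exists_mem_Ico_of_monotone (τ := τ) (s := s)
      (by rw [h0]; exact hs0.le) N (by rwa [h1])
    exact ⟨i, hi, lt_of_le_of_ne hi1 fun h => hsS ⟨i, h⟩, hi2⟩
  have hat : ∀ s ∈ Ioo (0 : ℝ) 1 \ range τ, ContDiffAt ℝ ∞ c s := by
    intro s hs
    obtain ⟨i, hi, hsi⟩ := hmem s hs
    exact (hsm i hi).contDiffAt (Icc_mem_nhds hsi.1 hsi.2)
  refine ⟨range τ, ⟨countable_range τ, ?_, ?_, ?_⟩, ?_⟩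
  · have key : ∀ k ≤ N, ContinuousOn c (Icc 0 (τ k)) := by
      intro k
      induction k with
      | zero => intro _; rw [h0, Icc_self]; exact continuousOn_singleton _ _
      | succ k ih =>
        intro hk
        rw [← Icc_union_Icc_eq_Icc (b := τ k) (by rw [← h0]; exact hτ (Nat.zero_le _))
          (hτ (Nat.le_succ _))]
        exact (ih (by omega)).union_of_isClosed (hsm k (by omega)).continuousOn
          isClosed_Icc isClosed_Icc
    simpa [h1] using key N le_rfl
  · intro s hs
    exact ((hat s hs).differentiableAt (by simp)).hasDerivAt
  · have hb : ∀ i, ∃ R, 0 ≤ R ∧ (i < N → ∀ s ∈ Ioo (τ i) (τ (i + 1)), ‖deriv c s‖ ≤ R) := by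
      intro i
      by_cases hi : i < N ∧ τ i < τ (i + 1)
      · have hcont : ContinuousOn (derivWithin c (Icc (τ i) (τ (i + 1)))) (Icc (τ i) (τ (i + 1))) :=
          (hsm i hi.1).continuousOn_derivWithin (uniqueDiffOn_Icc hi.2) (by simp)
        obtain ⟨R, hR⟩ := isCompact_Icc.exists_bound_of_continuousOn hcont
        refine ⟨max R 0, le_max_right _ _, fun _ s hs => ?_⟩
        have := hR s (Ioo_subset_Icc_self hs)
        rw [derivWithin_of_mem_nhds (Icc_mem_nhds hs.1 hs.2)] at this
        exact this.trans (le_max_left _ _)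
      · refine ⟨0, le_rfl, fun h s hs => ?_⟩
        exact absurd ⟨h, hs.1.trans hs.2⟩ hi
    choose R hR0 hR using hb
    refine ⟨∑ i ∈ Finset.range N, R i, fun s hs => ?_⟩
    obtain ⟨i, hi, hsi⟩ := hmem s hs
    exact (hR i hi s hsi).trans
      (Finset.single_le_sum (f := R) (fun j _ => hR0 j) (Finset.mem_range.2 hi))
  · intro s hs
    have h := hat s hs
    have h2 : ContDiffAt ℝ 0 (deriv c) s :=
      (h.of_le (m := 0 + 1) (by norm_cast)).derivWithin le_rfl
    exact h2.continuousAt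

section PiecewiseDiff

variable {G : Type*} [NormedAddCommGroup G] [NormedSpace ℝ G] {c : ℝ → G} {S : Set ℝ}

lemma ae_mem_Ioo_diff (hS : S.Countable) :
    ∀ᵐ s ∂(volume.restrict (Ioc (0 : ℝ) 1)), s ∈ Ioo (0 : ℝ) 1 \ S := by
  have h1 : ∀ᵐ s ∂(volume : Measure ℝ), s ∉ S ∪ {1} :=
    (hS.union (countable_singleton 1)).ae_notMem volume
  rw [ae_restrict_iff' measurableSet_Ioc]
  filter_upwards [h1] with s hs hs2
  simp only [mem_union, mem_singleton_iff, not_or] at hs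
  exact ⟨⟨hs2.1, lt_of_le_of_ne hs2.2 hs.2⟩, hs.1⟩

lemma PiecewiseDiff.of_contDiff (hc : ContDiff ℝ 1 c) (hS : S.Countable) : PiecewiseDiff c S where
  countable := hS
  continuousOn := hc.continuous.continuousOn
  hasDerivAt s _ := (hc.differentiable (by simp) s).hasDerivAt
  bounded := by
    obtain ⟨R, hR⟩ := isCompact_Icc.exists_bound_of_continuousOn
      (hc.continuous_deriv le_rfl).continuousOn (s := Icc (0 : ℝ) 1)
    exact ⟨R, fun s hs => hR s (Ioo_subset_Icc_self hs.1)⟩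

lemma PiecewiseDiff.add {d : ℝ → G} (hc : PiecewiseDiff c S) (hd : PiecewiseDiff d S) :
    PiecewiseDiff (c + d) S where
  countable := hc.countable
  continuousOn := hc.continuousOn.add hd.continuousOn
  hasDerivAt s hs := ((hc.hasDerivAt s hs).add (hd.hasDerivAt s hs)).differentiableAt.hasDerivAt
  bounded := by
    obtain ⟨R, hR⟩ := hc.bounded
    obtain ⟨R', hR'⟩ := hd.bounded
    refine ⟨R + R', fun s hs => ?_⟩
    rw [((hc.hasDerivAt s hs).add (hd.hasDerivAt s hs)).deriv]
    exact norm_add_le_of_le (hR s hs) (hR' s hs)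

lemma PiecewiseDiff.deriv_add {d : ℝ → G} (hc : PiecewiseDiff c S) (hd : PiecewiseDiff d S)
    {s : ℝ} (hs : s ∈ Ioo (0 : ℝ) 1 \ S) :
    deriv (c + d) s = deriv c s + deriv d s :=
  ((hc.hasDerivAt s hs).add (hd.hasDerivAt s hs)).deriv

lemma PiecewiseDiff.integral_deriv [CompleteSpace G] (hc : PiecewiseDiff c S) (c' : ℝ → G)
    (hc' : ∀ s ∈ Ioo (0 : ℝ) 1 \ S, HasDerivAt c (c' s) s)
    {r : ℝ} (hr : r ∈ Icc (0 : ℝ) 1) (hi : IntervalIntegrable c' volume 0 1) :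
    ∫ s in (0 : ℝ)..r, c' s = c r - c 0 := by
  refine integral_eq_of_hasDerivAt_off_countable_of_le c c' hr.1 hc.countable
    (hc.continuousOn.mono (Icc_subset_Icc_right hr.2)) ?_ ?_
  · intro s hs
    exact hc' s ⟨⟨hs.1.1, hs.1.2.trans_le hr.2⟩, hs.2⟩
  · exact hi.mono_set (by rw [uIcc_of_le hr.1, uIcc_of_le zero_le_one]; exact Icc_subset_Icc_right hr.2)

/-- A continuous function of a bounded measurable map is integrable on the unit interval. -/
lemma integrableOn_comp_of_bounded {X H : Type*} [NormedAddCommGroup X] [ProperSpace X]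
    [NormedAddCommGroup H] {Φ : X → H} (hΦ : Continuous Φ) {y : ℝ → X}
    (hy : AEStronglyMeasurable y (volume.restrict (Ioc (0 : ℝ) 1))) {R : ℝ}
    (hR : ∀ᵐ s ∂(volume.restrict (Ioc (0 : ℝ) 1)), ‖y s‖ ≤ R) :
    IntegrableOn (fun s => Φ (y s)) (Ioc 0 1) := by
  obtain ⟨B, hB⟩ := (isCompact_closedBall (0 : X) R).exists_bound_of_continuousOn hΦ.continuousOn
  refine IntegrableOn.of_bound (C := B) (by simp) (hΦ.comp_aestronglyMeasurable hy) ?_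
  filter_upwards [hR] with s hs
  exact hB _ (by simpa using hs)

lemma PiecewiseDiff.exists_bound (hc : PiecewiseDiff c S) :
    ∃ R, (∀ s ∈ Icc (0 : ℝ) 1, ‖c s‖ ≤ R) ∧ ∀ s ∈ Ioo (0 : ℝ) 1 \ S, ‖deriv c s‖ ≤ R := by
  obtain ⟨R, hR⟩ := hc.bounded
  obtain ⟨R', hR'⟩ := isCompact_Icc.exists_bound_of_continuousOn hc.continuousOn
  exact ⟨max R' R, fun s hs => (hR' s hs).trans (le_max_left _ _),
    fun s hs => (hR s hs).trans (le_max_right _ _)⟩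

lemma PiecewiseDiff.aestronglyMeasurable (hc : PiecewiseDiff c S) :
    AEStronglyMeasurable c (volume.restrict (Ioc (0 : ℝ) 1)) :=
  (hc.continuousOn.mono Ioc_subset_Icc_self).aestronglyMeasurable measurableSet_Ioc

lemma aestronglyMeasurable_deriv_unit [FiniteDimensional ℝ G] (c : ℝ → G) :
    AEStronglyMeasurable (deriv c) (volume.restrict (Ioc (0 : ℝ) 1)) := by
  have : CompleteSpace G := FiniteDimensional.complete ℝ G
  exact (stronglyMeasurable_deriv c).aestronglyMeasurable

/-- A continuous function of the position and velocity of one or two curves is integrable. -/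
lemma PiecewiseDiff.integrableOn₂ {G' : Type*} [NormedAddCommGroup G'] [NormedSpace ℝ G']
    [FiniteDimensional ℝ G] [FiniteDimensional ℝ G'] {d : ℝ → G'} {H : Type*} [NormedAddCommGroup H]
    (hc : PiecewiseDiff c S) (hd : PiecewiseDiff d S)
    {Φ : (G × G) × (G' × G') → H} (hΦ : Continuous Φ) :
    IntegrableOn (fun s => Φ ((c s, deriv c s), (d s, deriv d s))) (Ioc 0 1) := by
  have : ProperSpace G := FiniteDimensional.proper_real G
  have : ProperSpace G' := FiniteDimensional.proper_real G'
  obtain ⟨R, hR1, hR2⟩ := hc.exists_bound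
  obtain ⟨R', hR1', hR2'⟩ := hd.exists_bound
  refine integrableOn_comp_of_bounded (R := max R R') hΦ
    ((hc.aestronglyMeasurable.prodMk (aestronglyMeasurable_deriv_unit c)).prodMk
      (hd.aestronglyMeasurable.prodMk (aestronglyMeasurable_deriv_unit d))) ?_
  filter_upwards [ae_mem_Ioo_diff hc.countable] with s hs
  have h1 := hR1 s (Ioo_subset_Icc_self hs.1)
  have h2 := hR2 s hs
  have h3 := hR1' s (Ioo_subset_Icc_self hs.1)
  have h4 := hR2' s hs
  exact max_le (max_le (h1.trans (le_max_left _ _)) (h2.trans (le_max_left _ _)))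
    (max_le (h3.trans (le_max_right _ _)) (h4.trans (le_max_right _ _)))

lemma PiecewiseDiff.integrableOn [FiniteDimensional ℝ G] {H : Type*} [NormedAddCommGroup H]
    (hc : PiecewiseDiff c S) {Φ : G × G → H} (hΦ : Continuous Φ) :
    IntegrableOn (fun s => Φ (c s, deriv c s)) (Ioc 0 1) :=
  hc.integrableOn₂ hc (Φ := fun z => Φ z.1) (by fun_prop)

end PiecewiseDiff

end

section

/-! ### The energy and its perturbations -/

/-- The energy density `vᵀ M(x) v` as a function on the tangent bundle. -/
def energyDensity {n : ℕ} (M : E n → Matrix (Fin n) (Fin n) ℝ) (z : E n × E n) : ℝ :=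
  form (M z.1) z.2 z.2

/-- The metric is smooth and bounded below by a multiple `a⁻¹` of the Euclidean metric. -/
structure IsCoerciveMetric {n : ℕ} (M : E n → Matrix (Fin n) (Fin n) ℝ) (a : ℝ) : Prop where
  contDiff : ContDiff ℝ ∞ (energyDensity M)
  pos : 0 < a
  coercive : ∀ x v, ‖v‖ ^ 2 ≤ a * energyDensity M (x, v)

variable {n : ℕ} {M : E n → Matrix (Fin n) (Fin n) ℝ} {a : ℝ} {c : ℝ → E n} {S : Set ℝ}

lemma energyDensity_smul (x v : E n) (r : ℝ) :
    energyDensity M (x, r • v) = r ^ 2 * energyDensity M (x, v) := by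
  simp only [energyDensity, form, WithLp.ofLp_smul, Matrix.mulVec_smul, smul_dotProduct,
    dotProduct_smul, smul_eq_mul]
  ring

lemma energy_eq (c : ℝ → E n) :
    energy M c = ∫ s in Ioc (0 : ℝ) 1, energyDensity M (c s, deriv c s) :=
  intervalIntegral.integral_of_le zero_le_one

namespace IsCoerciveMetric

lemma nonneg (hM : IsCoerciveMetric M a) (z : E n × E n) : 0 ≤ energyDensity M z :=
  nonneg_of_mul_nonneg_right ((sq_nonneg _).trans (hM.coercive z.1 z.2)) hM.pos

lemma energy_nonneg (hM : IsCoerciveMetric M a) (c : ℝ → E n) : 0 ≤ energy M c := by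
  rw [energy_eq]
  exact integral_nonneg fun s => hM.nonneg _

lemma integrableOn (hM : IsCoerciveMetric M a) (hc : PiecewiseDiff c S) :
    IntegrableOn (fun s => energyDensity M (c s, deriv c s)) (Ioc 0 1) :=
  hc.integrableOn hM.contDiff.continuous

lemma bddBelow (hM : IsCoerciveMetric M a) (x y : E n) : BddBelow (energy M '' Paths x y) :=
  ⟨0, by rintro _ ⟨c, -, rfl⟩; exact hM.energy_nonneg c⟩

lemma minEnergy_le (hM : IsCoerciveMetric M a) {x y : E n} (hc : c ∈ Paths x y) :
    minEnergy M x y ≤ energy M c :=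
  csInf_le (hM.bddBelow x y) ⟨c, hc, rfl⟩

lemma minEnergy_nonneg (hM : IsCoerciveMetric M a) (x y : E n) : 0 ≤ minEnergy M x y :=
  Real.sInf_nonneg (by rintro _ ⟨c, -, rfl⟩; exact hM.energy_nonneg c)

end IsCoerciveMetric

lemma IsMinimalPath.energy_eq {x y : E n} (h : IsMinimalPath M x y c) :
    energy M c = minEnergy M x y :=
  le_antisymm (le_csInf ⟨_, c, h.1, rfl⟩ (by rintro _ ⟨d, hd, rfl⟩; exact h.2 d hd))
    (csInf_le ⟨_, by rintro _ ⟨d, hd, rfl⟩; exact h.2 d hd⟩ ⟨c, h.1, rfl⟩)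

lemma mem_paths_of_contDiff (hc : ContDiff ℝ ∞ c) : c ∈ Paths (c 0) (c 1) :=
  ⟨rfl, rfl, 1, fun i => (i : ℝ), Nat.mono_cast, by simp, by simp, fun _ _ => hc.contDiffOn⟩

lemma add_mem_paths {x y : E n} (hc : c ∈ Paths x y) {η : ℝ → E n} (hη : ContDiff ℝ ∞ η) :
    c + η ∈ Paths (x + η 0) (y + η 1) := by
  obtain ⟨h0, h1, N, τ, hτ, ht0, ht1, h⟩ := hc
  exact ⟨by simp [h0], by simp [h1], N, τ, hτ, ht0, ht1, fun i hi => (h i hi).add hη.contDiffOn⟩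

lemma energyDensity_zero (x : E n) : energyDensity M (x, 0) = 0 := by
  simp [energyDensity, form]

lemma minEnergy_self (hM : IsCoerciveMetric M a) (x : E n) : minEnergy M x x = 0 := by
  refine le_antisymm ?_ (hM.minEnergy_nonneg x x)
  refine (hM.minEnergy_le (c := fun _ => x) (mem_paths_of_contDiff contDiff_const)).trans ?_
  simp [energy_eq, energyDensity_zero]

namespace IsCoerciveMetric

/-- The weight `1 + ‖c'‖²` dominates both the speed and the variation of the energy density, and
coercivity bounds its integral by the energy alone. -/
lemma integral_one_add_sq_le (hM : IsCoerciveMetric M a) (hc : PiecewiseDiff c S) :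
    IntegrableOn (fun s => 1 + ‖deriv c s‖ ^ 2) (Ioc 0 1) ∧
    ∫ s in Ioc (0 : ℝ) 1, (1 + ‖deriv c s‖ ^ 2) ≤ 1 + a * energy M c := by
  have hi : IntegrableOn (fun s => 1 + ‖deriv c s‖ ^ 2) (Ioc 0 1) :=
    hc.integrableOn (Φ := fun z => 1 + ‖z.2‖ ^ 2) (by fun_prop)
  refine ⟨hi, ?_⟩
  have h1 : IntegrableOn (fun s => 1 + a * energyDensity M (c s, deriv c s)) (Ioc 0 1) :=
    (integrable_const _).add ((hM.integrableOn hc).const_mul a)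
  refine (integral_mono hi h1 fun s => add_le_add_right (hM.coercive (c s) (deriv c s)) 1).trans ?_
  rw [integral_add (integrable_const _) ((hM.integrableOn hc).const_mul a), integral_const_mul,
    energy_eq]
  simp

/-- A path of bounded energy stays in a bounded region. -/
lemma norm_sub_le (hM : IsCoerciveMetric M a) (hc : PiecewiseDiff c S) {s : ℝ}
    (hs : s ∈ Icc (0 : ℝ) 1) : ‖c s - c 0‖ ≤ 1 + a * energy M c := by
  have hi : IntervalIntegrable (deriv c) volume 0 1 :=
    (intervalIntegrable_iff_integrableOn_Ioc_of_le zero_le_one).2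
      (hc.integrableOn (Φ := Prod.snd) continuous_snd)
  obtain ⟨h1, h2⟩ := hM.integral_one_add_sq_le hc
  rw [← hc.integral_deriv (deriv c) hc.hasDerivAt hs hi]
  refine (intervalIntegral.norm_integral_le_integral_norm hs.1).trans (le_trans ?_ h2)
  rw [intervalIntegral.integral_of_le hs.1]
  calc ∫ r in Ioc 0 s, ‖deriv c r‖ ≤ ∫ r in Ioc 0 s, (1 + ‖deriv c r‖ ^ 2) := by
        refine integral_mono (IntegrableOn.mono_set hi.1.norm (Ioc_subset_Ioc_right hs.2))
          (h1.mono_set (Ioc_subset_Ioc_right hs.2)) fun r => ?_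
        nlinarith [sq_nonneg (‖deriv c r‖ - 1)]
    _ ≤ _ := setIntegral_mono_set h1 (Eventually.of_forall fun r => by positivity)
        (Ioc_subset_Ioc_right hs.2).eventuallyLE

/-- The energy density changes by at most `K δ (1 + ‖v‖²)` when position and velocity change by at
most `δ ≤ 1`, uniformly over bounded positions. -/
lemma exists_energyDensity_sub_le (hM : IsCoerciveMetric M a) (R : ℝ) :
    ∃ K, 0 ≤ K ∧ ∀ (x v y w : E n) (δ : ℝ), ‖x‖ ≤ R → δ ≤ 1 → ‖y‖ ≤ δ → ‖w‖ ≤ δ →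
      |energyDensity M (x + y, v + w) - energyDensity M (x, v)| ≤ K * δ * (1 + ‖v‖ ^ 2) := by
  -- The radius leaves room for perturbations of size at most 1: positions up to `R + 1`, velocities
  -- up to `1 + 1`. Larger velocities are reduced to this case by homogeneity.
  obtain ⟨K, hK⟩ := (hM.contDiff.contDiffOn (s := Metric.closedBall (0 : E n × E n) (max (R + 1) 2))
    ).exists_lipschitzOnWith (by simp) (convex_closedBall _ _) (isCompact_closedBall _ _)
  have key : ∀ (x v y w : E n) (δ : ℝ), ‖x‖ ≤ R → ‖v‖ ≤ 1 → δ ≤ 1 → ‖y‖ ≤ δ → ‖w‖ ≤ δ →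
      |energyDensity M (x + y, v + w) - energyDensity M (x, v)| ≤ K * δ := by
    intro x v y w δ hx hv hδ hy hw
    have h := hK.dist_le_mul (x + y, v + w) ?_ (x, v) ?_
    · rw [Real.dist_eq] at h
      refine h.trans (mul_le_mul_of_nonneg_left ?_ K.2)
      simp only [dist_eq_norm, Prod.mk_sub_mk, add_sub_cancel_left, Prod.norm_mk]
      exact max_le hy hw
    · rw [mem_closedBall_zero_iff, Prod.norm_mk]
      exact max_le_max ((norm_add_le _ _).trans (by linarith)) ((norm_add_le _ _).trans (by linarith))
    · rw [mem_closedBall_zero_iff, Prod.norm_mk]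
      exact max_le_max (by linarith) (by linarith)
  refine ⟨K, K.2, fun x v y w δ hx hδ hy hw => ?_⟩
  have hδ0 : 0 ≤ δ := (norm_nonneg _).trans hy
  have hKδ : 0 ≤ K * δ := mul_nonneg K.2 hδ0
  rcases le_total ‖v‖ 1 with hv | hv
  · refine (key x v y w δ hx hv hδ hy hw).trans ?_
    nlinarith [mul_nonneg hKδ (sq_nonneg ‖v‖)]
  · have hv0 : 0 < ‖v‖ := by linarith
    -- The density is quadratic in the velocity: rescale `v` to unit length. Since `‖v‖ ≥ 1`, the
    -- rescaled `w` is still at most `δ`, and scaling back costs the factor `‖v‖²`.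
    have h1 := key x (‖v‖⁻¹ • v) y (‖v‖⁻¹ • w) δ hx
      (by rw [norm_smul, norm_inv, norm_norm, inv_mul_cancel₀ hv0.ne']) hδ hy
      (by
        rw [norm_smul, norm_inv, norm_norm]
        exact (mul_le_of_le_one_left (norm_nonneg _) (inv_le_one_of_one_le₀ hv)).trans hw)
    rw [← smul_add, energyDensity_smul, energyDensity_smul, ← mul_sub, abs_mul,
      abs_of_nonneg (sq_nonneg _), inv_pow, inv_mul_le_iff₀ (by positivity)] at h1
    nlinarith

/-- Paths in a bounded region of bounded energy change their energy by `O(δ)` under smooth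
perturbations of `C¹` size `δ`. -/
lemma exists_energy_sub_le (hM : IsCoerciveMetric M a) (R : ℝ) :
    ∃ K, 0 ≤ K ∧ ∀ (c : ℝ → E n) (S : Set ℝ), PiecewiseDiff c S → (∀ s ∈ Icc (0 : ℝ) 1, ‖c s‖ ≤ R) →
      energy M c ≤ R → ∀ (η : ℝ → E n) (δ : ℝ), ContDiff ℝ ∞ η → δ ≤ 1 →
      (∀ s ∈ Icc (0 : ℝ) 1, ‖η s‖ ≤ δ ∧ ‖deriv η s‖ ≤ δ) →
      |energy M (c + η) - energy M c| ≤ K * δ := by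
  obtain ⟨K, hK0, hK⟩ := hM.exists_energyDensity_sub_le R
  refine ⟨K * (1 + a * max R 0), by have := hM.pos; positivity, ?_⟩
  intro c S hc hcR hcE η δ hη hδ1 hηδ
  have hδ0 : 0 ≤ δ := (norm_nonneg _).trans (hηδ 0 (by simp)).1
  have hη' : PiecewiseDiff η S := .of_contDiff (hη.of_le (by norm_cast)) hc.countable
  obtain ⟨h1, h2⟩ := hM.integral_one_add_sq_le hc
  have heq : energy M (c + η)
      = ∫ s in Ioc (0 : ℝ) 1, energyDensity M (c s + η s, deriv c s + deriv η s) := by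
    rw [energy_eq]
    refine integral_congr_ae ?_
    filter_upwards [ae_mem_Ioo_diff hc.countable] with s hs
    rw [hc.deriv_add hη' hs, Pi.add_apply]
  have hi : IntegrableOn (fun s => energyDensity M (c s + η s, deriv c s + deriv η s)) (Ioc 0 1) :=
    hc.integrableOn₂ hη' (Φ := fun z => energyDensity M (z.1.1 + z.2.1, z.1.2 + z.2.2))
      (hM.contDiff.continuous.comp (by fun_prop))
  rw [heq, energy_eq, ← integral_sub hi (hM.integrableOn hc), ← Real.norm_eq_abs]
  refine (norm_integral_le_of_norm_le (h1.const_mul (K * δ)) ?_).trans ?_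
  · filter_upwards [ae_mem_Ioo_diff hc.countable] with s hs
    have hs' := Ioo_subset_Icc_self hs.1
    exact hK _ _ _ _ _ (hcR s hs') hδ1 (hηδ s hs').1 (hηδ s hs').2
  · rw [integral_const_mul]
    have : 1 + a * energy M c ≤ 1 + a * max R 0 := by
      have := mul_le_mul_of_nonneg_left (hcE.trans (le_max_left R 0)) hM.pos.le
      linarith
    calc K * δ * _ ≤ K * δ * (1 + a * max R 0) :=
          mul_le_mul_of_nonneg_left (h2.trans this) (by positivity)
      _ = _ := by ring

/-- The derivative of the energy in the direction of a smooth vector field along the path. -/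
lemma hasDerivAt_energy (hM : IsCoerciveMetric M a) (hc : PiecewiseDiff c S) {V : ℝ → E n}
    (hV : ContDiff ℝ ∞ V) :
    HasDerivAt (fun h : ℝ => energy M (c + h • V))
      (∫ s in Ioc (0 : ℝ) 1, fderiv ℝ (energyDensity M) (c s, deriv c s) (V s, deriv V s)) 0 := by
  have hV' : PiecewiseDiff V S := .of_contDiff (hV.of_le (by norm_cast)) hc.countable
  have hdF : Continuous (fderiv ℝ (energyDensity M)) := hM.contDiff.continuous_fderiv (by simp)
  have heq : ∀ h : ℝ, energy M (c + h • V)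
      = ∫ s in Ioc (0 : ℝ) 1, energyDensity M (c s + h • V s, deriv c s + h • deriv V s) := by
    intro h
    rw [energy_eq]
    refine integral_congr_ae ?_
    filter_upwards [ae_mem_Ioo_diff hc.countable] with s hs
    rw [((hc.hasDerivAt s hs).add ((hV'.hasDerivAt s hs).const_smul h)).deriv]
    rfl
  have hi : ∀ h : ℝ, IntegrableOn
      (fun s => energyDensity M (c s + h • V s, deriv c s + h • deriv V s)) (Ioc 0 1) := fun h =>
    hc.integrableOn₂ hV' (Φ := fun z => energyDensity M (z.1.1 + h • z.2.1, z.1.2 + h • z.2.2))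
      (hM.contDiff.continuous.comp (by fun_prop))
  let F' : ℝ → ℝ → ℝ := fun h s => fderiv ℝ (energyDensity M)
    (c s + h • V s, deriv c s + h • deriv V s) (V s, deriv V s)
  have hi' : ∀ h : ℝ, IntegrableOn (F' h) (Ioc 0 1) := fun h =>
    hc.integrableOn₂ hV' (Φ := fun z => fderiv ℝ (energyDensity M)
      (z.1.1 + h • z.2.1, z.1.2 + h • z.2.2) z.2)
      ((hdF.comp (by fun_prop)).clm_apply continuous_snd)
  obtain ⟨R, hR1, hR2⟩ := hc.exists_bound
  obtain ⟨Q, hQ1, hQ2⟩ := hV'.exists_bound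
  -- For `|h| ≤ 1` the deformed positions and velocities stay in one ball, so the constant `B * Q`
  -- dominates the differentiated integrand.
  obtain ⟨B, hB⟩ := (isCompact_closedBall (0 : E n × E n) (R + Q)).exists_bound_of_continuousOn
    hdF.continuousOn
  have := (hasDerivAt_integral_of_dominated_loc_of_deriv_le (μ := volume.restrict (Ioc (0 : ℝ) 1))
    (F := fun h s => energyDensity M (c s + h • V s, deriv c s + h • deriv V s)) (F' := F')
    (x₀ := 0) (s := Metric.ball 0 1) (bound := fun _ => B * Q) (Metric.ball_mem_nhds _ one_pos)
    (Eventually.of_forall fun h => (hi h).aestronglyMeasurable) (hi 0)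
    (hi' 0).aestronglyMeasurable ?_ (integrable_const _) ?_).2
  · simpa [heq, F'] using this
  · filter_upwards [ae_mem_Ioo_diff hc.countable] with s hs h hh
    have hs' := Ioo_subset_Icc_self hs.1
    have hh1 : ‖h‖ ≤ 1 := by simpa using (mem_ball_zero_iff.1 hh).le
    have hz : ∀ v w : E n, ‖v‖ ≤ R → ‖w‖ ≤ Q → ‖v + h • w‖ ≤ R + Q := fun v w hv hw => by
      refine (norm_add_le _ _).trans (add_le_add hv ?_)
      rw [norm_smul]
      exact (mul_le_of_le_one_left (norm_nonneg _) hh1).trans hw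
    have hb := hB (c s + h • V s, deriv c s + h • deriv V s) (by
      rw [mem_closedBall_zero_iff, Prod.norm_mk]
      exact max_le (hz _ _ (hR1 s hs') (hQ1 s hs')) (hz _ _ (hR2 s hs) (hQ2 s hs)))
    refine ((fderiv ℝ (energyDensity M) _).le_opNorm _).trans ?_
    refine mul_le_mul hb ?_ (norm_nonneg _) ((norm_nonneg _).trans hb)
    exact max_le (hQ1 s hs') (hQ2 s hs)
  · refine Eventually.of_forall fun s h _ => ?_
    have h1 : HasDerivAt (fun h : ℝ => (c s + h • V s, deriv c s + h • deriv V s))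
        (V s, deriv V s) h := by
      have := ((hasDerivAt_id h).smul_const (V s)).const_add (c s)
      have h2 := ((hasDerivAt_id h).smul_const (deriv V s)).const_add (deriv c s)
      simpa using this.prodMk h2
    exact ((hM.contDiff.differentiable (by simp) _).hasFDerivAt).comp_hasDerivAt h h1

end IsCoerciveMetric

end

section

/-! ### The minimal energy between two moving points -/

variable {n : ℕ} {M : E n → Matrix (Fin n) (Fin n) ℝ} {a : ℝ} {c : ℝ → E n} {S : Set ℝ}

/-- The affine vector field on `[0, 1]` with prescribed end values. -/
def affineField (v w : E n) (s : ℝ) : E n := (1 - s) • v + s • w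

lemma affineField_contDiff (v w : E n) : ContDiff ℝ ∞ (affineField v w) := by
  unfold affineField; fun_prop

@[simp] lemma affineField_zero (v w : E n) : affineField v w 0 = v := by simp [affineField]

@[simp] lemma affineField_one (v w : E n) : affineField v w 1 = w := by simp [affineField]

lemma deriv_affineField (v w : E n) (s : ℝ) : deriv (affineField v w) s = w - v := by
  have h1 : HasDerivAt (fun s : ℝ => (1 - s) • v) ((-1 : ℝ) • v) s :=
    ((hasDerivAt_id s).const_sub 1).smul_const v
  have h2 : HasDerivAt (fun s : ℝ => s • w) ((1 : ℝ) • w) s := (hasDerivAt_id s).smul_const w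
  have := (h1.add h2).deriv
  rw [show affineField v w = (fun s : ℝ => (1 - s) • v) + fun s : ℝ => s • w from rfl, this]
  simp [sub_eq_neg_add]

lemma norm_affineField_le (v w : E n) {s : ℝ} (hs : s ∈ Icc (0 : ℝ) 1) :
    ‖affineField v w s‖ ≤ ‖v‖ + ‖w‖ ∧ ‖deriv (affineField v w) s‖ ≤ ‖v‖ + ‖w‖ := by
  constructor
  · refine (norm_add_le _ _).trans (add_le_add ?_ ?_)
    · rw [norm_smul, Real.norm_of_nonneg (by linarith [hs.2])]
      exact mul_le_of_le_one_left (norm_nonneg _) (by linarith [hs.1])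
    · rw [norm_smul, Real.norm_of_nonneg hs.1]
      exact mul_le_of_le_one_left (norm_nonneg _) hs.2
  · rw [deriv_affineField, add_comm]
    exact norm_sub_le _ _

namespace IsCoerciveMetric

/-- First variation of the minimal energy, along a smooth vector field. -/
lemma deriv_minEnergy_eq_of_contDiff (hM : IsCoerciveMetric M a) {x xs : ℝ → E n} {x' xs' : E n}
    {t e' : ℝ} (hx : HasDerivAt x x' t) (hxs : HasDerivAt xs xs' t)
    (he : HasDerivAt (fun τ => minEnergy M (xs τ) (x τ)) e' t)
    (hmin : IsMinimalPath M (xs t) (x t) c) (hc : PiecewiseDiff c S)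
    {V : ℝ → E n} (hV : ContDiff ℝ ∞ V) (hV0 : V 0 = xs') (hV1 : V 1 = x') :
    e' = ∫ s in Ioc (0 : ℝ) 1, fderiv ℝ (energyDensity M) (c s, deriv c s) (V s, deriv V s) := by
  have hV' : PiecewiseDiff V S := .of_contDiff (hV.of_le (by norm_cast)) hc.countable
  have hΦ := hM.hasDerivAt_energy hc hV
  set I := ∫ s in Ioc (0 : ℝ) 1, fderiv ℝ (energyDensity M) (c s, deriv c s) (V s, deriv V s)
  obtain ⟨R, hR, -⟩ := hc.exists_bound
  obtain ⟨Q, hQ, -⟩ := hV'.exists_bound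
  obtain ⟨K, hK0, hK⟩ := hM.exists_energy_sub_le (max (R + 1) (energy M c + 1))
  -- The remainders by which the ends of `c + h • V` miss the moving points. An affine field with
  -- these end values repairs the path; its `C¹` size is at most `δ h = o(h)`.
  let r₀ : ℝ → E n := fun h => xs (t + h) - xs t - h • xs'
  let r₁ : ℝ → E n := fun h => x (t + h) - x t - h • x'
  let δ : ℝ → ℝ := fun h => ‖r₀ h‖ + ‖r₁ h‖
  have hδ : δ =o[𝓝 0] fun h : ℝ => h :=
    (hasDerivAt_iff_isLittleO_nhds_zero.1 hxs).norm_left.add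
      (hasDerivAt_iff_isLittleO_nhds_zero.1 hx).norm_left
  have hδ0 : δ 0 = 0 := by simp [δ, r₀, r₁]
  have hδ' : HasDerivAt δ 0 0 := by
    rw [hasDerivAt_iff_isLittleO_nhds_zero]
    simpa [hδ0] using hδ
  -- Energy of the deformed path, plus the cost of the repair, minus the minimal energy: nonnegative
  -- near `h = 0`, zero at `h = 0`, and differentiable there. The vanishing of its derivative is the
  -- claim.
  have hψ : HasDerivAt (fun h => energy M (c + h • V) + K * δ h - minEnergy M (xs (t + h)) (x (t + h)))
      (I + K * 0 - e') 0 := by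
    refine (hΦ.add (hδ'.const_mul K)).sub ?_
    have he' : HasDerivAt (fun τ => minEnergy M (xs τ) (x τ)) e' (t + 0) := by simpa using he
    exact he'.comp_const_add t 0
  have hmin0 : IsLocalMin
      (fun h => energy M (c + h • V) + K * δ h - minEnergy M (xs (t + h)) (x (t + h))) 0 := by
    have e1 : ∀ᶠ h in 𝓝 (0 : ℝ), energy M (c + h • V) < energy M c + 1 := by
      refine hΦ.continuousAt.eventually_lt continuousAt_const ?_
      simp
    have e2 : ∀ᶠ h in 𝓝 (0 : ℝ), δ h < 1 :=
      hδ'.continuousAt.eventually_lt continuousAt_const (by simp [hδ0])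
    have e3 : ∀ᶠ h in 𝓝 (0 : ℝ), |h| * Q < 1 :=
      ContinuousAt.eventually_lt (by fun_prop) continuousAt_const (by simp)
    filter_upwards [e1, e2, e3] with h h1 h2 h3
    have hcV : PiecewiseDiff (c + h • V) S := by
      have hhV : PiecewiseDiff (h • V) S :=
        .of_contDiff ((hV.const_smul h).of_le (by norm_cast)) hc.countable
      exact hc.add hhV
    have hp := add_mem_paths (add_mem_paths hmin.1 (hV.const_smul h))
      (affineField_contDiff (r₀ h) (r₁ h))
    have hb := hK (c + h • V) S hcV (fun s hs => ?_) (h1.le.trans (le_max_right _ _))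
      (affineField (r₀ h) (r₁ h)) (δ h) (affineField_contDiff _ _) h2.le
      (fun s hs => norm_affineField_le _ _ hs)
    · have hle := hM.minEnergy_le hp
      have q0 : xs t + (h • V) 0 + affineField (r₀ h) (r₁ h) 0 = xs (t + h) := by
        simp [r₀, hV0]
      have q1 : x t + (h • V) 1 + affineField (r₀ h) (r₁ h) 1 = x (t + h) := by
        simp [r₁, hV1]
      have hle' : minEnergy M (xs (t + h)) (x (t + h))
          ≤ energy M (c + h • V + affineField (r₀ h) (r₁ h)) := by
        rw [← q0, ← q1]; exact hle
      have hz : energy M (c + (0 : ℝ) • V) + K * δ 0 - minEnergy M (xs (t + 0)) (x (t + 0)) = 0 := by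
        rw [hδ0]; simp [hmin.energy_eq]
      rw [hz]
      linarith [(abs_le.1 hb).2]
    · refine le_trans ((norm_add_le _ _).trans (add_le_add (hR s hs) ?_)) (le_max_left _ _)
      rw [Pi.smul_apply, norm_smul]
      exact (mul_le_mul_of_nonneg_left (hQ s hs) (norm_nonneg _)).trans h3.le
  have := hmin0.hasDerivAt_eq_zero hψ
  linarith

end IsCoerciveMetric

/-- A piecewise differentiable vector field is approximated by smooth ones with the same end values,
uniformly and with the derivatives in `L¹`. -/
lemma PiecewiseDiff.exists_contDiff_approx {V : ℝ → E n} (hV : PiecewiseDiff V S)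
    {ε : ℝ} (hε : 0 < ε) :
    ∃ U : ℝ → E n, ContDiff ℝ ∞ U ∧ U 0 = V 0 ∧ U 1 = V 1 ∧
      (∀ s ∈ Icc (0 : ℝ) 1, ‖U s - V s‖ ≤ ε) ∧
      ∫ s in Ioc (0 : ℝ) 1, ‖deriv U s - deriv V s‖ ≤ ε := by
  have hVi : IntegrableOn (deriv V) (Ioc 0 1) := hV.integrableOn (Φ := Prod.snd) continuous_snd
  -- Approximate the derivative rather than `V`: a smooth `g` close to `V'` in `L¹` has a primitive
  -- uniformly close to `V`.
  obtain ⟨g, -, hg, hgε⟩ := MemLp.exist_eLpNorm_sub_le (μ := volume) (p := 1) (by simp) le_rfl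
    (memLp_one_iff_integrable.2 ((integrable_indicator_iff measurableSet_Ioc).2 hVi))
    (half_pos hε)
  have hgi : ∀ s t : ℝ, IntervalIntegrable g volume s t := fun s t =>
    hg.continuous.intervalIntegrable s t
  have hgc : IntegrableOn g (Ioc 0 1) := (hgi 0 1).1
  have hdi : IntegrableOn (fun s => g s - deriv V s) (Ioc 0 1) := hgc.sub hVi
  have hgL : ∫ s in Ioc (0 : ℝ) 1, ‖g s - deriv V s‖ ≤ ε / 2 := by
    rw [integral_norm_eq_lintegral_enorm hdi.aestronglyMeasurable]
    refine ENNReal.toReal_le_of_le_ofReal (half_pos hε).le (le_trans ?_ hgε)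
    rw [eLpNorm_one_eq_lintegral_enorm]
    refine le_trans (le_of_eq (setLIntegral_congr_fun measurableSet_Ioc fun s hs => ?_))
      (setLIntegral_le_lintegral (Ioc 0 1) _)
    simp only [Pi.sub_apply, indicator_of_mem hs]
    rw [← enorm_neg, neg_sub]
  have hVint : ∀ s ∈ Icc (0 : ℝ) 1, ∫ r in (0 : ℝ)..s, deriv V r = V s - V 0 := fun s hs =>
    hV.integral_deriv (deriv V) hV.hasDerivAt hs
      ((intervalIntegrable_iff_integrableOn_Ioc_of_le zero_le_one).2 hVi)
  -- The defect of the primitive of `g` at the right end. Adding the constant `κ` to the derivative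
  -- restores the end value and costs at most another `ε / 2`.
  set κ : E n := (V 1 - V 0) - ∫ s in (0 : ℝ)..1, g s with hκ
  have hsub : ∀ s ∈ Icc (0 : ℝ) 1, ‖(∫ r in (0 : ℝ)..s, g r) - (V s - V 0)‖ ≤ ε / 2 := by
    intro s hs
    have hi : IntervalIntegrable (deriv V) volume 0 s :=
      (intervalIntegrable_iff_integrableOn_Ioc_of_le hs.1).2
        (hVi.mono_set (Ioc_subset_Ioc_right hs.2))
    rw [← hVint s hs, ← intervalIntegral.integral_sub (hgi 0 s) hi]
    refine (intervalIntegral.norm_integral_le_integral_norm hs.1).trans (le_trans ?_ hgL)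
    rw [intervalIntegral.integral_of_le hs.1]
    exact setIntegral_mono_set hdi.norm (Eventually.of_forall fun r => norm_nonneg _)
      (Ioc_subset_Ioc_right hs.2).eventuallyLE
  have hκε : ‖κ‖ ≤ ε / 2 := by
    rw [hκ, ← norm_neg, neg_sub]
    exact hsub 1 (by simp)
  let U : ℝ → E n := fun s => V 0 + ((∫ r in (0 : ℝ)..s, g r) + s • κ)
  have hU : ∀ s, HasDerivAt U (g s + κ) s := by
    intro s
    have h1 := intervalIntegral.integral_hasDerivAt_right (hgi 0 s)
      (hg.continuous.stronglyMeasurableAtFilter _ _) hg.continuous.continuousAt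
    have h2 : HasDerivAt (fun s : ℝ => s • κ) κ s := by
      simpa using (hasDerivAt_id s).smul_const κ
    exact (h1.add h2).const_add (V 0)
  have hU' : deriv U = fun s => g s + κ := funext fun s => (hU s).deriv
  refine ⟨U, ?_, by simp [U], by simp [U, hκ], ?_, ?_⟩
  · refine contDiff_infty_iff_deriv.2 ⟨fun s => (hU s).differentiableAt, ?_⟩
    rw [hU']
    exact hg.add contDiff_const
  · intro s hs
    have : U s - V s = ((∫ r in (0 : ℝ)..s, g r) - (V s - V 0)) + s • κ := by
      simp only [U]; abel
    rw [this]
    refine (norm_add_le _ _).trans ?_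
    have hsκ : ‖s • κ‖ ≤ ε / 2 := by
      rw [norm_smul, Real.norm_of_nonneg hs.1]
      exact (mul_le_of_le_one_left (norm_nonneg _) hs.2).trans hκε
    linarith [hsub s hs]
  · rw [hU']
    have hi2 : IntegrableOn (fun s => ‖g s - deriv V s‖ + ‖κ‖) (Ioc 0 1) :=
      hdi.norm.add (integrable_const _)
    calc ∫ s in Ioc (0 : ℝ) 1, ‖g s + κ - deriv V s‖
        ≤ ∫ s in Ioc (0 : ℝ) 1, (‖g s - deriv V s‖ + ‖κ‖) := by
          refine integral_mono ((hgc.add (integrable_const κ)).sub hVi).norm hi2 fun s => ?_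
          have : g s + κ - deriv V s = (g s - deriv V s) + κ := by abel
          simp only [this]
          exact norm_add_le _ _
      _ = (∫ s in Ioc (0 : ℝ) 1, ‖g s - deriv V s‖) + ‖κ‖ := by
          rw [integral_add hdi.norm (integrable_const _)]; simp
      _ ≤ ε := by linarith

namespace IsCoerciveMetric

/-- First variation of the minimal energy, along a piecewise differentiable vector field. -/
lemma deriv_minEnergy_eq (hM : IsCoerciveMetric M a) {x xs : ℝ → E n} {x' xs' : E n}
    {t e' : ℝ} (hx : HasDerivAt x x' t) (hxs : HasDerivAt xs xs' t)
    (he : HasDerivAt (fun τ => minEnergy M (xs τ) (x τ)) e' t)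
    (hmin : IsMinimalPath M (xs t) (x t) c) (hc : PiecewiseDiff c S)
    {V : ℝ → E n} (hV : PiecewiseDiff V S) (hV0 : V 0 = xs') (hV1 : V 1 = x') :
    e' = ∫ s in Ioc (0 : ℝ) 1, fderiv ℝ (energyDensity M) (c s, deriv c s) (V s, deriv V s) := by
  have hdF : Continuous (fderiv ℝ (energyDensity M)) := hM.contDiff.continuous_fderiv (by simp)
  obtain ⟨R, hR1, hR2⟩ := hc.exists_bound
  obtain ⟨B, hB⟩ := (isCompact_closedBall (0 : E n × E n) R).exists_bound_of_continuousOn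
    hdF.continuousOn
  have hB0 : 0 ≤ max B 0 := le_max_right _ _
  have hint : ∀ {U : ℝ → E n}, PiecewiseDiff U S → IntegrableOn
      (fun s => fderiv ℝ (energyDensity M) (c s, deriv c s) (U s, deriv U s)) (Ioc 0 1) := fun hU =>
    hc.integrableOn₂ hU (Φ := fun z => fderiv ℝ (energyDensity M) z.1 z.2)
      ((hdF.comp continuous_fst).clm_apply continuous_snd)
  rw [← sub_eq_zero, ← abs_eq_zero]
  refine le_antisymm (le_of_forall_pos_le_add fun ε hε => ?_) (abs_nonneg _)
  -- The left side does not see the field, and the integral is continuous in it. With `B` bounding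
  -- the differential of the density along `c`, passing from `U` to `V` costs at most `2 * max B 0 *
  -- ε'`; hence the choice of tolerance.
  obtain ⟨U, hU, hU0, hU1, hUs, hUi⟩ := hV.exists_contDiff_approx
    (ε := ε / (2 * (max B 0 + 1))) (by positivity)
  have hU' : PiecewiseDiff U S := .of_contDiff (hU.of_le (by norm_cast)) hc.countable
  set ε' := ε / (2 * (max B 0 + 1)) with hε'
  rw [hM.deriv_minEnergy_eq_of_contDiff hx hxs he hmin hc hU (hU0.trans hV0) (hU1.trans hV1),
    ← integral_sub (hint hU') (hint hV), ← Real.norm_eq_abs]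
  have hi : IntegrableOn (fun s => ‖deriv U s - deriv V s‖) (Ioc 0 1) :=
    hU'.integrableOn₂ hV (Φ := fun z => ‖z.1.2 - z.2.2‖) (by fun_prop)
  have hi2 : IntegrableOn (fun s => max B 0 * (ε' + ‖deriv U s - deriv V s‖)) (Ioc 0 1) :=
    ((integrable_const _).add hi).const_mul _
  refine (norm_integral_le_of_norm_le hi2 ?_).trans ?_
  · filter_upwards [ae_mem_Ioo_diff hc.countable] with s hs
    have hs' := Ioo_subset_Icc_self hs.1
    rw [← map_sub]
    have hb := hB (c s, deriv c s) (by
      rw [mem_closedBall_zero_iff, Prod.norm_mk]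
      exact max_le (hR1 s hs') (hR2 s hs))
    refine ((fderiv ℝ (energyDensity M) _).le_opNorm _).trans ?_
    refine mul_le_mul (hb.trans (le_max_left _ _)) ?_ (norm_nonneg _) hB0
    rw [Prod.mk_sub_mk, Prod.norm_mk]
    have hus := hUs s hs'
    exact max_le (by linarith [norm_nonneg (deriv U s - deriv V s)])
      (by linarith [norm_nonneg (U s - V s)])
  · rw [integral_const_mul, integral_add (integrable_const _) hi]
    simp only [integral_const, measureReal_restrict_apply, MeasurableSet.univ, univ_inter,
      Real.volume_real_Ioc, sub_zero, smul_eq_mul]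
    norm_num
    have h3 : ε = 2 * (max B 0 + 1) * ε' := by rw [hε']; field_simp
    have h4 : 0 < ε' := by rw [hε']; positivity
    have := mul_le_mul_of_nonneg_left hUi hB0
    nlinarith

/-- The minimal energy between two absolutely continuous trajectories is absolutely continuous,
provided that minimal paths exist. -/
lemma absolutelyContinuousOnInterval_minEnergy (hM : IsCoerciveMetric M a) {x xs : ℝ → E n} {T : ℝ}
    (hT : 0 ≤ T) (hx : AbsolutelyContinuousOnInterval x 0 T)
    (hxs : AbsolutelyContinuousOnInterval xs 0 T)
    (hmin : ∀ t ∈ Icc 0 T, ∃ c, IsMinimalPath M (xs t) (x t) c) :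
    AbsolutelyContinuousOnInterval (fun t => minEnergy M (xs t) (x t)) 0 T := by
  obtain ⟨r, hr⟩ := isCompact_Icc.exists_bound_of_continuousOn
    (by simpa [uIcc_of_le hT] using hx.continuousOn)
  obtain ⟨r', hr'⟩ := isCompact_Icc.exists_bound_of_continuousOn
    (by simpa [uIcc_of_le hT] using hxs.continuousOn)
  obtain ⟨b, hb⟩ := (isCompact_closedBall (0 : E n × E n) (r' + r)).exists_bound_of_continuousOn
    hM.contDiff.continuous.continuousOn
  have heb : ∀ t ∈ Icc 0 T, minEnergy M (xs t) (x t) ≤ b := by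
    intro t ht
    have h := hM.minEnergy_le (mem_paths_of_contDiff (affineField_contDiff (xs t) (x t)))
    rw [affineField_zero, affineField_one] at h
    refine h.trans ?_
    rw [energy_eq]
    have hn : ∀ s ∈ Ioc (0 : ℝ) 1, ‖energyDensity M (affineField (xs t) (x t) s,
        deriv (affineField (xs t) (x t)) s)‖ ≤ b := by
      intro s hs
      have h1 := norm_affineField_le (xs t) (x t) (Ioc_subset_Icc_self hs)
      refine hb _ ?_
      rw [mem_closedBall_zero_iff, Prod.norm_mk]
      have h2 := add_le_add (hr' t ht) (hr t ht)
      exact max_le (h1.1.trans h2) (h1.2.trans h2)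
    have := norm_setIntegral_le_of_norm_le_const (μ := volume) (s := Ioc (0 : ℝ) 1) (by simp) hn
    simpa using (le_abs_self _).trans this
  have he0 : ∀ t, 0 ≤ minEnergy M (xs t) (x t) := fun t => hM.minEnergy_nonneg _ _
  have hb0 : ∀ t ∈ Icc 0 T, 0 ≤ b := fun t ht => (he0 t).trans (heb t ht)
  -- A minimal path starts within `r'` of the origin and has energy at most `b`, the bound obtained
  -- from segments, so it stays within `r' + (1 + a * b)`. One constant `K` thus serves all times.
  obtain ⟨K, hK0, hK⟩ := hM.exists_energy_sub_le (max b (r' + (1 + a * b)))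
  have hone : ∀ t ∈ Icc 0 T, ∀ τ ∈ Icc 0 T, minEnergy M (xs τ) (x τ) - minEnergy M (xs t) (x t)
      ≤ (K + b) * (dist (xs t) (xs τ) + dist (x t) (x τ)) := by
    intro t ht τ hτ
    rw [dist_comm (xs t), dist_comm (x t), dist_eq_norm, dist_eq_norm]
    set δ := ‖xs τ - xs t‖ + ‖x τ - x t‖ with hδ
    have hδ0 : 0 ≤ δ := by positivity
    -- If `δ ≤ 1`, shift a minimal path at `t` by an affine field to join the end points at `τ`. If
    -- `δ ≥ 1`, the trivial bound `b ≤ b * δ` suffices.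
    rcases le_total δ 1 with h1 | h1
    · obtain ⟨c, hc⟩ := hmin t ht
      obtain ⟨S, hcS, -⟩ := exists_piecewiseDiff_of_mem_paths hc.1
      have hce := hc.energy_eq
      have hcb : energy M c ≤ b := hce.trans_le (heb t ht)
      have hk := hK c S hcS (fun s hs => ?_) (hcb.trans (le_max_left _ _))
        (affineField (xs τ - xs t) (x τ - x t)) δ (affineField_contDiff _ _) h1
        (fun s hs => norm_affineField_le _ _ hs)
      · have h2 := hM.minEnergy_le (add_mem_paths hc.1
          (affineField_contDiff (xs τ - xs t) (x τ - x t)))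
        rw [affineField_zero, affineField_one, add_sub_cancel, add_sub_cancel] at h2
        have h3 := (abs_le.1 hk).2
        have := mul_nonneg (hb0 t ht) hδ0
        nlinarith
      · have h2 := hM.norm_sub_le hcS hs
        rw [hc.1.1] at h2
        have h3 : ‖c s‖ ≤ ‖c s - xs t‖ + ‖xs t‖ := by simpa using norm_add_le (c s - xs t) (xs t)
        have h4 := mul_le_mul_of_nonneg_left hcb hM.pos.le
        exact le_trans (by linarith [hr' t ht]) (le_max_right _ _)
    · have := heb τ hτ
      have := he0 t
      have := mul_nonneg hK0 hδ0
      have := mul_le_mul_of_nonneg_left h1 (hb0 t ht)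
      nlinarith
  have hlim := (Tendsto.add hxs hx).const_mul (K + b)
  rw [add_zero, mul_zero] at hlim
  refine squeeze_zero' (Eventually.of_forall fun _ => Finset.sum_nonneg fun _ _ => dist_nonneg)
    ?_ hlim
  rw [eventually_inf_principal]
  refine Eventually.of_forall fun I hI => ?_
  rw [← Finset.sum_add_distrib, Finset.mul_sum]
  refine Finset.sum_le_sum fun i hi => ?_
  have h := hI.1 i hi
  rw [uIcc_of_le hT] at h
  rw [Real.dist_eq, abs_sub_le_iff]
  have h1 := hone _ h.1 _ h.2
  have h2 := hone _ h.2 _ h.1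
  rw [dist_comm (xs _), dist_comm (x _)] at h2
  exact ⟨h2, h1⟩

end IsCoerciveMetric

end

section

/-! ### The metric `M = W⁻¹` -/

lemma contDiff_det {X : Type*} [NormedAddCommGroup X] [NormedSpace ℝ X] {k : ℕ}
    {A : X → Matrix (Fin k) (Fin k) ℝ} {r : ℕ∞ω} (hA : ∀ i j, ContDiff ℝ r fun x => A x i j) :
    ContDiff ℝ r fun x => (A x).det := by
  simp only [Matrix.det_apply']
  exact ContDiff.sum fun σ _ => contDiff_const.mul (contDiff_prod fun i _ => hA _ _)

lemma contDiff_inv {X : Type*} [NormedAddCommGroup X] [NormedSpace ℝ X] {k : ℕ}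
    {A : X → Matrix (Fin k) (Fin k) ℝ} {r : ℕ∞ω} (hA : ∀ i j, ContDiff ℝ r fun x => A x i j)
    (h0 : ∀ x, (A x).det ≠ 0) (i j : Fin k) : ContDiff ℝ r fun x => (A x)⁻¹ i j := by
  simp only [Matrix.inv_def, Ring.inverse_eq_inv', Matrix.smul_apply, smul_eq_mul,
    Matrix.adjugate_apply]
  refine ((contDiff_det hA).inv h0).mul (contDiff_det fun i' j' => ?_)
  simp only [Matrix.updateRow_apply]
  split_ifs
  · exact contDiff_const
  · exact hA _ _

lemma contDiff_energyDensity {n : ℕ} {M : E n → Matrix (Fin n) (Fin n) ℝ}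
    (hM : ∀ i j, ContDiff ℝ ∞ fun x => M x i j) : ContDiff ℝ ∞ (energyDensity M) := by
  unfold energyDensity form
  simp only [dotProduct, Matrix.mulVec]
  have h1 : ∀ i, ContDiff ℝ ∞ fun z : E n × E n => z.2.ofLp i := fun i => by fun_prop
  exact ContDiff.sum fun i _ => (h1 i).mul
    (ContDiff.sum fun j _ => ((hM i j).comp contDiff_fst).mul (h1 j))

lemma norm_sq_eq_dotProduct {k : ℕ} (v : E k) : ‖v‖ ^ 2 = v.ofLp ⬝ᵥ v.ofLp := by
  rw [EuclideanSpace.real_norm_sq_eq]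
  simp [dotProduct, sq]

/-- If `W` is positive definite with `W ≤ b I` and `v = W ξ`, then `|v|² ≤ b ξᵀ W ξ`. -/
lemma dotProduct_mulVec_le {k : ℕ} {W : Matrix (Fin k) (Fin k) ℝ} (hW : W.PosDef) {b : ℝ}
    (hb : 0 < b) (hWb : (b • (1 : Matrix (Fin k) (Fin k) ℝ) - W).PosSemidef) (ξ : Fin k → ℝ) :
    (W *ᵥ ξ) ⬝ᵥ (W *ᵥ ξ) ≤ b * (ξ ⬝ᵥ (W *ᵥ ξ)) := by
  have hsymm : Wᵀ = W := by simpa using hW.1.eq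
  set v := W *ᵥ ξ with hv
  have h1 : 0 ≤ b * (v ⬝ᵥ v) - v ⬝ᵥ (W *ᵥ v) := by
    simpa [Matrix.sub_mulVec, Matrix.smul_mulVec, dotProduct_sub] using
      hWb.dotProduct_mulVec_nonneg v
  -- Positivity of `W` at `v - b ξ`. Added to `h1`, it cancels `vᵀ W v` and leaves `b (b ξᵀ v -
  -- |v|²) ≥ 0`.
  have h2 : 0 ≤ v ⬝ᵥ (W *ᵥ v) - b * (v ⬝ᵥ v) - (b * (v ⬝ᵥ v) - b * (b * (ξ ⬝ᵥ v))) := by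
    have h := hW.posSemidef.dotProduct_mulVec_nonneg (v - b • ξ)
    have h3 : ξ ⬝ᵥ (W *ᵥ v) = v ⬝ᵥ v := by
      rw [Matrix.dotProduct_mulVec, ← Matrix.mulVec_transpose, hsymm]
    simpa [Matrix.mulVec_sub, Matrix.mulVec_smul, ← hv, sub_dotProduct, dotProduct_sub, h3,
      smul_dotProduct, dotProduct_smul, mul_sub] using h
  have h4 : 0 ≤ b * (b * (ξ ⬝ᵥ v) - v ⬝ᵥ v) := by linarith
  have := nonneg_of_mul_nonneg_right h4 hb
  linarith

/-! ### Velocity and momentum: the energy density of `W⁻¹` -/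

section Inverse

variable {n : ℕ} {W : E n → Matrix (Fin n) (Fin n) ℝ}

lemma IsUniformlyBoundedMetric.det_ne_zero (hW : IsUniformlyBoundedMetric W) (x : E n) :
    (W x).det ≠ 0 := (hW.posDef x).det_pos.ne'

lemma IsUniformlyBoundedMetric.mulVec_inv_mulVec (hW : IsUniformlyBoundedMetric W) (x : E n)
    (v : Fin n → ℝ) : W x *ᵥ ((W x)⁻¹ *ᵥ v) = v := by
  rw [Matrix.mulVec_mulVec, Matrix.mul_nonsing_inv _ (Ne.isUnit (hW.det_ne_zero x)),
    Matrix.one_mulVec]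

lemma IsUniformlyBoundedMetric.energyDensity_inv (hW : IsUniformlyBoundedMetric W) (x v : E n) :
    energyDensity (fun x => (W x)⁻¹) (x, v)
      = ((W x)⁻¹ *ᵥ v.ofLp) ⬝ᵥ (W x *ᵥ ((W x)⁻¹ *ᵥ v.ofLp)) := by
  rw [hW.mulVec_inv_mulVec, dotProduct_comm]
  rfl

/-- The upper bound `W ≤ a₂ I` becomes the lower bound `W⁻¹ ≥ a₂⁻¹ I`; smoothness of the inverse
comes from Cramer's rule. -/
lemma IsUniformlyBoundedMetric.exists_isCoerciveMetric (hW : IsUniformlyBoundedMetric W) :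
    ∃ a, IsCoerciveMetric (fun x => (W x)⁻¹) a := by
  obtain ⟨a₁, a₂, h0, h12, hb⟩ := hW.bounded
  refine ⟨a₂, contDiff_energyDensity (contDiff_inv hW.smooth hW.det_ne_zero), h0.trans_le h12,
    fun x v => ?_⟩
  have h := dotProduct_mulVec_le (hW.posDef x) (h0.trans_le h12) (hb x).2 ((W x)⁻¹ *ᵥ v.ofLp)
  rw [← hW.energyDensity_inv, hW.mulVec_inv_mulVec] at h
  rwa [norm_sq_eq_dotProduct]

lemma hasDerivAt_form {d k l : ℕ} {F : E d → Matrix (Fin k) (Fin l) ℝ} {y : ℝ → E d} {y' : E d}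
    {s : ℝ} (hF : ∀ i j, DifferentiableAt ℝ (fun x => F x i j) (y s)) (hy : HasDerivAt y y' s)
    (ξ : E k) (ζ : E l) :
    HasDerivAt (fun h => form (F (y h)) ξ ζ) (form (matDeriv F (y s) y') ξ ζ) s := by
  simp only [form, dotProduct, Matrix.mulVec, matDeriv, Matrix.of_apply]
  exact HasDerivAt.fun_sum fun i _ => (HasDerivAt.fun_sum fun j _ =>
    ((hF i j).hasFDerivAt.comp_hasDerivAt s hy).mul_const (ζ.ofLp j)).const_mul (ξ.ofLp i)

/-- The derivative of the energy density of `W⁻¹` in terms of the momentum `ξ = W⁻¹ v`. It follows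
from `vᵀ W⁻¹ v = max_ξ (2 ξᵀ v - ξᵀ W ξ)`. -/
lemma IsUniformlyBoundedMetric.fderiv_energyDensity (hW : IsUniformlyBoundedMetric W)
    (x v V V' : E n) :
    fderiv ℝ (energyDensity fun x => (W x)⁻¹) (x, v) (V, V')
      = 2 * (((W x)⁻¹ *ᵥ v.ofLp) ⬝ᵥ V'.ofLp)
        - ((W x)⁻¹ *ᵥ v.ofLp) ⬝ᵥ (matDeriv W x V *ᵥ ((W x)⁻¹ *ᵥ v.ofLp)) := by
  obtain ⟨a, hM⟩ := hW.exists_isCoerciveMetric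
  set ξ : Fin n → ℝ := (W x)⁻¹ *ᵥ v.ofLp with hξ
  have hline : ∀ z w : E n, HasDerivAt (fun h : ℝ => z + h • w) w 0 := fun z w => by
    simpa using ((hasDerivAt_id (0 : ℝ)).smul_const w).const_add z
  have h1 : HasDerivAt (fun h : ℝ => energyDensity (fun x => (W x)⁻¹) (x + h • V, v + h • V'))
      (fderiv ℝ (energyDensity fun x => (W x)⁻¹) (x, v) (V, V')) 0 := by
    have hd := (hM.contDiff.differentiable (by simp) (x, v)).hasFDerivAt
    have hl := (hline x V).prodMk (hline v V')
    have : HasFDerivAt (energyDensity fun x => (W x)⁻¹)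
      (fderiv ℝ (energyDensity fun x => (W x)⁻¹) (x, v))
      (x + (0 : ℝ) • V, v + (0 : ℝ) • V') := by simpa using hd
    exact this.comp_hasDerivAt (0 : ℝ) hl
  have h2 : HasDerivAt (fun h : ℝ => 2 * (ξ ⬝ᵥ (v + h • V').ofLp)
      - form (W (x + h • V)) (WithLp.toLp 2 ξ) (WithLp.toLp 2 ξ))
      (2 * (ξ ⬝ᵥ V'.ofLp) - form (matDeriv W x V) (WithLp.toLp 2 ξ) (WithLp.toLp 2 ξ)) 0 := by
    refine HasDerivAt.sub ?_ ?_
    · simp only [WithLp.ofLp_add, WithLp.ofLp_smul, dotProduct_add, dotProduct_smul, smul_eq_mul]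
      simpa using (((hasDerivAt_id (0 : ℝ)).mul_const (ξ ⬝ᵥ V'.ofLp)).const_add
        (ξ ⬝ᵥ v.ofLp)).const_mul 2
    · have := hasDerivAt_form (F := W) (y := fun h : ℝ => x + h • V) (s := 0)
        (fun i j => ((hW.smooth i j).differentiable (by simp)).differentiableAt) (hline x V)
        (WithLp.toLp 2 ξ) (WithLp.toLp 2 ξ)
      simpa using this
  -- With `ξ` frozen at its value for `(x, v)`, this is positivity of `W y` at `η - ξ`, where `η` is
  -- the momentum of `u` at `y`.
  have hle : ∀ y u : E n, 2 * (ξ ⬝ᵥ u.ofLp) - form (W y) (WithLp.toLp 2 ξ) (WithLp.toLp 2 ξ)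
      ≤ energyDensity (fun x => (W x)⁻¹) (y, u) := by
    intro y u
    rw [hW.energyDensity_inv]
    have hsymm : (W y)ᵀ = W y := by simpa using (hW.posDef y).1.eq
    set η := (W y)⁻¹ *ᵥ u.ofLp
    have hu : u.ofLp = W y *ᵥ η := (hW.mulVec_inv_mulVec y _).symm
    have h := (hW.posDef y).posSemidef.dotProduct_mulVec_nonneg (η - ξ)
    have h3 : η ⬝ᵥ (W y *ᵥ ξ) = ξ ⬝ᵥ (W y *ᵥ η) := by
      rw [Matrix.dotProduct_mulVec, ← Matrix.mulVec_transpose, hsymm, dotProduct_comm]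
    rw [hu]
    simp only [star_trivial, Matrix.mulVec_sub, sub_dotProduct, dotProduct_sub, h3] at h
    simp only [form]
    linarith
  have heq : 2 * (ξ ⬝ᵥ v.ofLp) - form (W x) (WithLp.toLp 2 ξ) (WithLp.toLp 2 ξ)
      = energyDensity (fun x => (W x)⁻¹) (x, v) := by
    rw [hW.energyDensity_inv, ← hξ]
    have hu : v.ofLp = W x *ᵥ ξ := (hW.mulVec_inv_mulVec x _).symm
    rw [hu]
    simp only [form]
    ring
  -- The density touches its lower bound at `(x, v)`, so both have the same derivative there, and
  -- that of the lower bound involves `W` only, not its inverse.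
  have hmin : IsLocalMin (fun h : ℝ => energyDensity (fun x => (W x)⁻¹) (x + h • V, v + h • V')
      - (2 * (ξ ⬝ᵥ (v + h • V').ofLp)
        - form (W (x + h • V)) (WithLp.toLp 2 ξ) (WithLp.toLp 2 ξ))) 0 := by
    refine Eventually.of_forall fun h => ?_
    have := hle (x + h • V) (v + h • V')
    simp only [zero_smul, add_zero]
    linarith
  have := hmin.hasDerivAt_eq_zero (h1.sub h2)
  simp only [form] at this
  linarith

end Inverse

/-! ### Consequences of the synthesis conditions -/

section LMI

variable {n m p q : ℕ} {P : Plant n m p q} {W : E n → Matrix (Fin n) (Fin n) ℝ}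
  {Y : E n → Matrix (Fin m) (Fin n) ℝ} {lam μ α : ℝ} {x : E n} {u : E m} {w : E p}

/-- The first inequality tested on `(ξ, ζ)`. For `ξ = W⁻¹ v` one has `W ξ = v` and `Y ξ = K v`, so
the left side is the derivative of the energy density along the differential closed loop. -/
lemma two_mul_dotProduct_le_of_lmi₁ (h₁ : (-(lmi₁ P W Y lam μ x u w)).PosSemidef)
    (ξ : Fin n → ℝ) (ζ : Fin p → ℝ) :
    2 * (ξ ⬝ᵥ (P.A x u w *ᵥ (W x *ᵥ ξ) + P.B x *ᵥ (Y x *ᵥ ξ) + P.Bw x *ᵥ ζ))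
        - ξ ⬝ᵥ (matDeriv W x (P.rhs x u w) *ᵥ ξ)
      ≤ -(lam * (ξ ⬝ᵥ (W x *ᵥ ξ))) + μ * (ζ ⬝ᵥ ζ) := by
  have h := h₁.dotProduct_mulVec_nonneg (Sum.elim ξ ζ)
  have ht : ∀ Z : Matrix (Fin n) (Fin n) ℝ, ξ ⬝ᵥ (Zᵀ *ᵥ ξ) = ξ ⬝ᵥ (Z *ᵥ ξ) := fun Z => by
    rw [Matrix.mulVec_transpose, dotProduct_comm, ← Matrix.dotProduct_mulVec]
  have hb : ζ ⬝ᵥ ((P.Bw x)ᵀ *ᵥ ξ) = ξ ⬝ᵥ (P.Bw x *ᵥ ζ) := by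
    rw [Matrix.mulVec_transpose, dotProduct_comm, ← Matrix.dotProduct_mulVec]
  simp only [star_trivial, lmi₁, Matrix.neg_mulVec, Matrix.fromBlocks_mulVec, dotProduct_neg,
    Sum.elim_comp_inl, Sum.elim_comp_inr, sumElim_dotProduct_sumElim,
    dotProduct_add, hb, Matrix.add_mulVec, Matrix.sub_mulVec, dotProduct_sub, ht, Matrix.smul_mulVec,
    Matrix.one_mulVec, dotProduct_smul, smul_eq_mul, ← Matrix.mulVec_mulVec,
    Matrix.transpose_add] at h
  simp only [dotProduct_add]
  have e1 := ht (P.A x u w * W x)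
  have e2 := ht (P.B x * Y x)
  simp only [← Matrix.mulVec_mulVec] at e1 e2
  linarith

/-- The second inequality tested on `(ξ, 0, y)`; its middle block enters only through `μ ≤ α`. -/
lemma nonneg_of_lmi₂ (h₂ : (lmi₂ P W Y lam μ α x u).PosSemidef)
    (ξ : Fin n → ℝ) (y : Fin q → ℝ) :
    0 ≤ lam * (ξ ⬝ᵥ (W x *ᵥ ξ))
      + 2 * (y ⬝ᵥ (P.C x u *ᵥ (W x *ᵥ ξ) + P.D x u *ᵥ (Y x *ᵥ ξ))) + α * (y ⬝ᵥ y) := by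
  have h := h₂.dotProduct_mulVec_nonneg (Sum.elim (Sum.elim ξ 0) y)
  have ht : ξ ⬝ᵥ ((P.C x u * W x + P.D x u * Y x)ᵀ *ᵥ y)
      = y ⬝ᵥ (P.C x u *ᵥ (W x *ᵥ ξ) + P.D x u *ᵥ (Y x *ᵥ ξ)) := by
    rw [Matrix.mulVec_transpose, dotProduct_comm, ← Matrix.dotProduct_mulVec, Matrix.add_mulVec,
      Matrix.mulVec_mulVec, Matrix.mulVec_mulVec]
  simp only [star_trivial, lmi₂, Matrix.fromBlocks_mulVec, Sum.elim_comp_inl, Sum.elim_comp_inr,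
    sumElim_dotProduct_sumElim, Matrix.fromRows_mulVec, Matrix.fromCols_mulVec, dotProduct_add,
    ← Sum.elim_add_add, Matrix.zero_mulVec, Matrix.mulVec_zero, add_zero, zero_dotProduct,
    ht, Matrix.smul_mulVec, Matrix.one_mulVec, dotProduct_smul, smul_eq_mul, Matrix.add_mulVec,
    ← Matrix.mulVec_mulVec] at h ⊢
  linarith

lemma le_of_lmi₂ (h₂ : (lmi₂ P W Y lam μ α x u).PosSemidef) (i : Fin p) : μ ≤ α := by
  have h := h₂.diag_nonneg (i := Sum.inl (Sum.inr i))
  simpa [lmi₂] using h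

end LMI

end

section

/-! ### Linearization of the plant along curves -/

section Curves

variable {G : Type*} [NormedAddCommGroup G] [NormedSpace ℝ G] {c : ℝ → G} {S : Set ℝ}

lemma PiecewiseDiff.prodMk {G' : Type*} [NormedAddCommGroup G'] [NormedSpace ℝ G'] {d : ℝ → G'}
    (hc : PiecewiseDiff c S) (hd : PiecewiseDiff d S) : PiecewiseDiff (fun s => (c s, d s)) S where
  countable := hc.countable
  continuousOn := hc.continuousOn.prodMk hd.continuousOn
  hasDerivAt s hs := ((hc.hasDerivAt s hs).prodMk (hd.hasDerivAt s hs)).differentiableAt.hasDerivAt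
  bounded := by
    obtain ⟨R, hR⟩ := hc.bounded
    obtain ⟨R', hR'⟩ := hd.bounded
    refine ⟨max R R', fun s hs => ?_⟩
    rw [((hc.hasDerivAt s hs).prodMk (hd.hasDerivAt s hs)).deriv]
    exact max_le_max (hR s hs) (hR' s hs)

lemma PiecewiseDiff.comp [FiniteDimensional ℝ G] {H : Type*} [NormedAddCommGroup H]
    [NormedSpace ℝ H] {Φ : G → H} (hΦ : ContDiff ℝ 1 Φ) (hc : PiecewiseDiff c S) :
    PiecewiseDiff (fun s => Φ (c s)) S := by
  have hd : ∀ s ∈ Ioo (0 : ℝ) 1 \ S,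
      HasDerivAt (fun s => Φ (c s)) (fderiv ℝ Φ (c s) (deriv c s)) s := fun s hs =>
    (hΦ.differentiable (by simp) _).hasFDerivAt.comp_hasDerivAt s (hc.hasDerivAt s hs)
  refine ⟨hc.countable, hΦ.continuous.comp_continuousOn hc.continuousOn,
    fun s hs => (hd s hs).differentiableAt.hasDerivAt, ?_⟩
  have : ProperSpace G := FiniteDimensional.proper_real G
  obtain ⟨R, hR1, hR2⟩ := hc.exists_bound
  obtain ⟨B, hB⟩ := (isCompact_closedBall (0 : G) R).exists_bound_of_continuousOn
    (hΦ.continuous_fderiv (by simp)).continuousOn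
  refine ⟨B * R, fun s hs => ?_⟩
  rw [(hd s hs).deriv]
  have hb := hB (c s) (mem_closedBall_zero_iff.2 (hR1 s (Ioo_subset_Icc_self hs.1)))
  exact ((fderiv ℝ Φ (c s)).le_opNorm _).trans
    (mul_le_mul hb (hR2 s hs) (norm_nonneg _) ((norm_nonneg _).trans hb))

/-- The primitive of a bounded function which is continuous off `S`. -/
lemma PiecewiseDiff.of_primitive {H : Type*} [NormedAddCommGroup H] [NormedSpace ℝ H]
    [CompleteSpace H] {k : ℝ → H} (hS : S.Countable) (hk : IntegrableOn k (Ioc 0 1))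
    (hkc : ∀ s ∈ Ioo (0 : ℝ) 1 \ S, ContinuousAt k s) {R : ℝ}
    (hR : ∀ s ∈ Ioo (0 : ℝ) 1 \ S, ‖k s‖ ≤ R) (v : H) :
    PiecewiseDiff (fun s => v + ∫ r in (0 : ℝ)..s, k r) S ∧
      ∀ s ∈ Ioo (0 : ℝ) 1 \ S, HasDerivAt (fun s => v + ∫ r in (0 : ℝ)..s, k r) (k s) s := by
  have hd : ∀ s ∈ Ioo (0 : ℝ) 1 \ S,
      HasDerivAt (fun s => v + ∫ r in (0 : ℝ)..s, k r) (k s) s := fun s hs =>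
    (intervalIntegral.integral_hasDerivAt_right
      ((intervalIntegrable_iff_integrableOn_Ioc_of_le hs.1.1.le).2
        (hk.mono_set (Ioc_subset_Ioc_right hs.1.2.le)))
      ⟨Ioc 0 1, Ioc_mem_nhds hs.1.1 hs.1.2, hk.aestronglyMeasurable⟩ (hkc s hs)).const_add v
  refine ⟨⟨hS, ?_, fun s hs => (hd s hs).differentiableAt.hasDerivAt, R, fun s hs => ?_⟩, hd⟩
  · have h := intervalIntegral.continuousOn_primitive_interval (μ := volume) (f := k) (a := 0)
      (b := 1) (by rwa [uIcc_of_le zero_le_one, integrableOn_Icc_iff_integrableOn_Ioc])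
    rw [uIcc_of_le zero_le_one] at h
    exact continuousOn_const.add h
  · rw [(hd s hs).deriv]
    exact hR s hs

end Curves

lemma ofLp_fderiv {k l : ℕ} {h : E k → E l} {x : E k} (hh : DifferentiableAt ℝ h x) (v : E k)
    (i : Fin l) : fderiv ℝ h x v i = fderiv ℝ (fun y => h y i) x v := by
  have h1 := (EuclideanSpace.proj (𝕜 := ℝ) i).hasFDerivAt.comp x hh.hasFDerivAt
  have h2 : HasFDerivAt (fun y => h y i)
    ((EuclideanSpace.proj (𝕜 := ℝ) i).comp (fderiv ℝ h x)) x := h1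
  rw [h2.fderiv]
  rfl

lemma jac_mulVec {k l : ℕ} (h : E k → E l) (x v : E k) :
    jac h x *ᵥ v.ofLp = (fderiv ℝ h x v).ofLp := by
  have hv : v = ∑ j, v j • EuclideanSpace.single j (1 : ℝ) := by
    ext i
    simp [Pi.single_apply]
  funext i
  conv_rhs => rw [hv, map_sum]
  simp [jac, Matrix.mulVec, dotProduct, mul_comm]

lemma hasDerivAt_euclidean_iff {k : ℕ} {y : ℝ → E k} {y' : E k} {s : ℝ} :
    HasDerivAt y y' s ↔ ∀ i, HasDerivAt (fun r => y r i) (y' i) s := by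
  simp only [hasDerivAt_iff_hasFDerivAt]
  rw [← hasFDerivWithinAt_univ, hasFDerivWithinAt_euclidean]
  refine forall_congr' fun i => ?_
  rw [hasFDerivWithinAt_univ]
  refine iff_of_eq ?_
  congr 1

lemma hasDerivAt_app {d k l : ℕ} {B : E d → Matrix (Fin k) (Fin l) ℝ}
    (hB : ∀ i j, Differentiable ℝ fun x => B x i j) {y : ℝ → E d} {y' : E d} {ν : ℝ → E l}
    {ν' : E l} {s : ℝ} (hy : HasDerivAt y y' s) (hν : HasDerivAt ν ν' s) :
    HasDerivAt (fun r => app (B (y r)) (ν r))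
      (WithLp.toLp 2 ((∑ i, ν s i • jac (fun y => WithLp.toLp 2 fun k => B y k i) (y s)) *ᵥ y'.ofLp
        + B (y s) *ᵥ ν'.ofLp)) s := by
  rw [hasDerivAt_euclidean_iff] at hν ⊢
  intro i
  have hcol : ∀ j, DifferentiableAt ℝ (fun y => (WithLp.toLp 2 fun k => B y k j : E k)) (y s) := by
    intro j
    rw [differentiableAt_euclidean]
    exact fun i => hB i j _
  have h1 : HasDerivAt (fun r => ∑ j, B (y r) i j * ν r j)
      (∑ j, (fderiv ℝ (fun x => B x i j) (y s) y' * ν s j + B (y s) i j * ν' j)) s :=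
    HasDerivAt.fun_sum fun j _ => (((hB i j) _).hasFDerivAt.comp_hasDerivAt s hy).mul (hν j)
  have h2 : ∑ j, (fderiv ℝ (fun x => B x i j) (y s) y' * ν s j + B (y s) i j * ν' j)
      = (WithLp.toLp 2 ((∑ i, ν s i • jac (fun y => WithLp.toLp 2 fun k => B y k i) (y s))
        *ᵥ y'.ofLp + B (y s) *ᵥ ν'.ofLp) : E k) i := by
    simp only [Matrix.sum_mulVec, Matrix.smul_mulVec, jac_mulVec, Pi.add_apply, Finset.sum_apply,
      Pi.smul_apply, smul_eq_mul, Finset.sum_add_distrib]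
    congr 1
    refine Finset.sum_congr rfl fun j _ => ?_
    rw [ofLp_fderiv (hcol j), mul_comm]
  rw [← h2]
  exact h1

lemma contDiff_app {X : Type*} [NormedAddCommGroup X] [NormedSpace ℝ X] {k l : ℕ} {r : ℕ∞ω}
    {B : X → Matrix (Fin k) (Fin l) ℝ} (hB : ∀ i j, ContDiff ℝ r fun x => B x i j) {ν : X → E l}
    (hν : ContDiff ℝ r ν) : ContDiff ℝ r fun x => app (B x) (ν x) := by
  rw [contDiff_euclidean] at hν ⊢
  intro i
  simp only [app, Matrix.mulVec, dotProduct]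
  exact ContDiff.sum fun j _ => (hB i j).mul (hν j)

section Plant

variable {n m p q : ℕ} {P : Plant n m p q}

lemma Plant.IsC1.contDiff_rhs (hP : P.IsC1) :
    ContDiff ℝ 1 fun z : E n × E m × E p => P.rhs z.1 z.2.1 z.2.2 :=
  ((hP.f.comp contDiff_fst).add
    (contDiff_app (fun i j => (hP.B i j).comp contDiff_fst) (by fun_prop))).add
    (contDiff_app (fun i j => (hP.Bw i j).comp contDiff_fst) (by fun_prop))

/-- The chain rule yields the differential dynamics; differentiating `B(y) ν` and `B_w(y) ζ` in `y`
column by column produces the sums in `A`. -/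
lemma Plant.IsC1.hasDerivAt_rhs (hP : P.IsC1) {y : ℝ → E n} {y' : E n} {ν : ℝ → E m} {ν' : E m}
    {ζ : ℝ → E p} {ζ' : E p} {s : ℝ} (hy : HasDerivAt y y' s) (hν : HasDerivAt ν ν' s)
    (hζ : HasDerivAt ζ ζ' s) :
    HasDerivAt (fun r => P.rhs (y r) (ν r) (ζ r))
      (WithLp.toLp 2 (P.A (y s) (ν s) (ζ s) *ᵥ y'.ofLp + P.B (y s) *ᵥ ν'.ofLp
        + P.Bw (y s) *ᵥ ζ'.ofLp)) s := by
  have h1 := (hP.f.differentiable (by simp) _).hasFDerivAt.comp_hasDerivAt s hy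
  have h2 := hasDerivAt_app (fun i j => (hP.B i j).differentiable (by simp)) hy hν
  have h3 := hasDerivAt_app (fun i j => (hP.Bw i j).differentiable (by simp)) hy hζ
  convert! (h1.add h2).add h3 using 1
  apply WithLp.ofLp_injective
  simp only [Plant.A, Matrix.add_mulVec, jac_mulVec, WithLp.ofLp_add]
  abel

lemma Plant.IsC1.hasDerivAt_g (hP : P.IsC1) {y : ℝ → E n} {y' : E n} {ν : ℝ → E m} {ν' : E m}
    {s : ℝ} (hy : HasDerivAt y y' s) (hν : HasDerivAt ν ν' s) :
    HasDerivAt (fun r => P.g (y r) (ν r))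
      (WithLp.toLp 2 (P.C (y s) (ν s) *ᵥ y'.ofLp + P.D (y s) (ν s) *ᵥ ν'.ofLp)) s := by
  have hG := (hP.g.differentiable (by simp) (y s, ν s)).hasFDerivAt
  have h1 := hG.comp_hasDerivAt s (hy.prodMk hν)
  convert! h1 using 1
  apply WithLp.ofLp_injective
  set L := fderiv ℝ (fun a : E n × E m => P.g a.1 a.2) (y s, ν s)
  have e1 : HasFDerivAt (fun y => P.g y (ν s)) (L.comp (.inl ℝ (E n) (E m))) (y s) :=
    HasFDerivAt.comp (g := fun a : E n × E m => P.g a.1 a.2) (f := fun x => (x, ν s)) (y s) hG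
      (hasFDerivAt_prodMk_left (y s) (ν s))
  have e2 : HasFDerivAt (fun v => P.g (y s) v) (L.comp (.inr ℝ (E n) (E m))) (ν s) :=
    HasFDerivAt.comp (g := fun a : E n × E m => P.g a.1 a.2) (f := fun v => (y s, v)) (ν s) hG
      (hasFDerivAt_prodMk_right (y s) (ν s))
  simp only [Plant.C, Plant.D, jac_mulVec, e1.fderiv, e2.fderiv, ← WithLp.ofLp_add]
  congr 1
  simp only [ContinuousLinearMap.comp_apply, ← map_add]
  simp

end Plant

end

section

/-! ### Dissipation and output bounds along a minimal path -/

section Feedback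

variable {n m p q : ℕ} {c : ℝ → E n}

lemma continuous_app {k l : ℕ} {X : Type*} [TopologicalSpace X] {A : X → Matrix (Fin k) (Fin l) ℝ}
    (hA : ∀ i j, Continuous fun x => A x i j) {v : X → E l} (hv : Continuous v) :
    Continuous fun x => app (A x) (v x) := by
  refine (PiLp.continuous_toLp 2 _).comp (continuous_pi fun i => ?_)
  simp only [Matrix.mulVec, dotProduct]
  exact continuous_finsetSum _ fun j _ => (hA i j).mul (by fun_prop)

/-- The input along a path, obtained by integrating the differential feedback. -/
lemma exists_piecewiseDiff_feedback {K : E n → Matrix (Fin m) (Fin n) ℝ}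
    (hK : ∀ i j, Continuous fun x => K x i j) {a b : E n} (hc : c ∈ Paths a b) (us : E m) :
    ∃ S, PiecewiseDiff c S ∧
      PiecewiseDiff (fun s => us + ∫ r in (0 : ℝ)..s, app (K (c r)) (deriv c r)) S ∧
      ∀ s ∈ Ioo (0 : ℝ) 1 \ S,
        HasDerivAt (fun s => us + ∫ r in (0 : ℝ)..s, app (K (c r)) (deriv c r))
          (app (K (c s)) (deriv c s)) s := by
  obtain ⟨S, hcS, hcont⟩ := exists_piecewiseDiff_of_mem_paths hc
  have hk : Continuous fun z : E n × E n => app (K z.1) z.2 :=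
    continuous_app (fun i j => (hK i j).comp continuous_fst) continuous_snd
  obtain ⟨R, hR1, hR2⟩ := hcS.exists_bound
  obtain ⟨B, hB⟩ := (isCompact_closedBall (0 : E n × E n) R).exists_bound_of_continuousOn
    hk.continuousOn
  refine ⟨S, hcS, PiecewiseDiff.of_primitive hcS.countable (hcS.integrableOn hk)
    (fun s hs => ?_) (R := B) (fun s hs => ?_) us⟩
  · exact ContinuousAt.comp (g := fun z : E n × E n => app (K z.1) z.2)
      (f := fun s => (c s, deriv c s)) hk.continuousAt
      ((hcS.hasDerivAt s hs).continuousAt.prodMk (hcont s hs))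
  · refine hB (c s, deriv c s) (mem_closedBall_zero_iff.2 ?_)
    exact max_le (hR1 s (Ioo_subset_Icc_self hs.1)) (hR2 s hs)

variable {P : Plant n m p q} {W : E n → Matrix (Fin n) (Fin n) ℝ}
  {Y : E n → Matrix (Fin m) (Fin n) ℝ} {lam μ α : ℝ}

lemma IsUniformlyBoundedMetric.continuous_gain (hW : IsUniformlyBoundedMetric W)
    (hY : ∀ i j, Continuous fun x => Y x i j) (i : Fin m) (j : Fin n) :
    Continuous fun x => (Y x * (W x)⁻¹) i j := by
  simp only [Matrix.mul_apply]
  exact continuous_finsetSum _ fun k _ => (hY i k).mul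
    (contDiff_inv hW.smooth hW.det_ne_zero k j).continuous

/-- The differential dissipation inequality: the minimal energy decays up to the disturbance. -/
lemma deriv_minEnergy_le (hP : P.IsC1) (hW : IsUniformlyBoundedMetric W)
    (hY : ∀ i j, Continuous fun x => Y x i j)
    (h₁ : ∀ (x : E n) (u : E m) (w : E p), (-(lmi₁ P W Y lam μ x u w)).PosSemidef)
    {x xs : ℝ → E n} {u us : E m} {w ws : E p} {t e' : ℝ}
    (hx : HasDerivAt x (P.rhs (x t) u w) t) (hxs : HasDerivAt xs (P.rhs (xs t) us ws) t)
    (he : HasDerivAt (fun τ => minEnergy (fun x => (W x)⁻¹) (xs τ) (x τ)) e' t)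
    (hmin : IsMinimalPath (fun x => (W x)⁻¹) (xs t) (x t) c)
    (hu : u = (∫ s in (0 : ℝ)..1, app (Y (c s) * (W (c s))⁻¹) (deriv c s)) + us) :
    e' ≤ -(lam * minEnergy (fun x => (W x)⁻¹) (xs t) (x t)) + μ * ‖w - ws‖ ^ 2 := by
  obtain ⟨a, hM⟩ := hW.exists_isCoerciveMetric
  obtain ⟨S, hc, hν, hν'⟩ := exists_piecewiseDiff_feedback (hW.continuous_gain hY) hmin.1 us
  set ν : ℝ → E m := fun s => us + ∫ r in (0 : ℝ)..s, app (Y (c r) * (W (c r))⁻¹) (deriv c r)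
  -- Linear interpolation has constant velocity `w - ws`, so its squared speed integrates to exactly
  -- `‖w - ws‖ ^ 2`.
  let ζ : ℝ → E p := fun s => ws + s • (w - ws)
  have hζ' : ∀ s, HasDerivAt ζ (w - ws) s := fun s => by
    have := ((hasDerivAt_id s).smul_const (w - ws)).const_add ws
    rwa [one_smul] at this
  have hζ : PiecewiseDiff ζ S := .of_contDiff (by fun_prop) hc.countable
  let V : ℝ → E n := fun s => P.rhs (c s) (ν s) (ζ s)
  have hV : PiecewiseDiff V S := PiecewiseDiff.comp
    (Φ := fun z : E n × E m × E p => P.rhs z.1 z.2.1 z.2.2) hP.contDiff_rhs (hc.prodMk (hν.prodMk hζ))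
  have hV0 : V 0 = P.rhs (xs t) us ws := by simp [V, ν, ζ, hmin.1.1]
  -- The controller enters here: the feedback integrated over the whole path is `u - us`.
  have hV1 : V 1 = P.rhs (x t) u w := by simp [V, ν, ζ, hmin.1.2.1, hu, add_comm]
  rw [hM.deriv_minEnergy_eq hx hxs he hmin hc hV hV0 hV1, ← hmin.energy_eq, energy_eq]
  have hdF : Continuous (fderiv ℝ (energyDensity fun x => (W x)⁻¹)) :=
    hM.contDiff.continuous_fderiv (by simp)
  have hi1 : IntegrableOn (fun s => fderiv ℝ (energyDensity fun x => (W x)⁻¹)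
      (c s, deriv c s) (V s, deriv V s)) (Ioc 0 1) :=
    hc.integrableOn₂ hV (Φ := fun z => fderiv ℝ (energyDensity fun x => (W x)⁻¹) z.1 z.2)
      ((hdF.comp continuous_fst).clm_apply continuous_snd)
  have hi2 : IntegrableOn (fun s => -(lam * energyDensity (fun x => (W x)⁻¹) (c s, deriv c s)))
    (Ioc 0 1) := ((hM.integrableOn hc).const_mul lam).neg
  have hi3 : IntegrableOn (fun s => -(lam * energyDensity (fun x => (W x)⁻¹) (c s, deriv c s))
      + μ * ‖w - ws‖ ^ 2) (Ioc 0 1) := hi2.add (integrable_const _)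
  refine (integral_mono_ae hi1 hi3 ?_).trans (le_of_eq ?_)
  · filter_upwards [ae_mem_Ioo_diff hc.countable] with s hs
    have hV' := hP.hasDerivAt_rhs (hc.hasDerivAt s hs) (hν' s hs) (hζ' s)
    have h := two_mul_dotProduct_le_of_lmi₁ (h₁ (c s) (ν s) (ζ s))
      ((W (c s))⁻¹ *ᵥ (deriv c s).ofLp) (w - ws).ofLp
    rw [hW.fderiv_energyDensity, hW.energyDensity_inv, norm_sq_eq_dotProduct, hV'.deriv]
    rw [hW.mulVec_inv_mulVec] at h ⊢
    simpa [app, Matrix.mulVec_mulVec] using h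
  · rw [integral_add hi2 (integrable_const _), integral_neg, integral_const_mul]
    simp

/-- The output deviation is controlled by the minimal energy. -/
lemma norm_output_sub_sq_le (hP : P.IsC1) (hW : IsUniformlyBoundedMetric W)
    (hY : ∀ i j, Continuous fun x => Y x i j) (hα : 0 < α)
    (h₂ : ∀ (x : E n) (u : E m), (lmi₂ P W Y lam μ α x u).PosSemidef)
    {x xs : E n} {u us : E m} (hmin : IsMinimalPath (fun x => (W x)⁻¹) xs x c)
    (hu : u = (∫ s in (0 : ℝ)..1, app (Y (c s) * (W (c s))⁻¹) (deriv c s)) + us) :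
    ‖P.g x u - P.g xs us‖ ^ 2 ≤ α * lam * minEnergy (fun x => (W x)⁻¹) xs x := by
  obtain ⟨a, hM⟩ := hW.exists_isCoerciveMetric
  obtain ⟨S, hc, hν, hν'⟩ := exists_piecewiseDiff_feedback (hW.continuous_gain hY) hmin.1 us
  set ν : ℝ → E m := fun s => us + ∫ r in (0 : ℝ)..s, app (Y (c r) * (W (c r))⁻¹) (deriv c r)
  let Z : ℝ → E q := fun s => P.g (c s) (ν s)
  have hZ : PiecewiseDiff Z S := PiecewiseDiff.comp hP.g (hc.prodMk hν)
  have hZ0 : Z 0 = P.g xs us := by simp [Z, ν, hmin.1.1]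
  have hZ1 : Z 1 = P.g x u := by simp [Z, ν, hmin.1.2.1, hu, add_comm]
  have hZi : IntegrableOn (deriv Z) (Ioc 0 1) := hZ.integrableOn (Φ := Prod.snd) continuous_snd
  set Δ := P.g x u - P.g xs us with hΔ
  have hint : ∫ s in Ioc (0 : ℝ) 1, inner ℝ Δ (deriv Z s) = ‖Δ‖ ^ 2 := by
    rw [integral_inner hZi, ← intervalIntegral.integral_of_le zero_le_one,
      hZ.integral_deriv (deriv Z) hZ.hasDerivAt (right_mem_Icc.2 zero_le_one)
        ((intervalIntegrable_iff_integrableOn_Ioc_of_le zero_le_one).2 hZi),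
      hZ1, hZ0, ← hΔ, real_inner_self_eq_norm_sq]
  have hi1 := (hM.integrableOn hc).const_mul lam
  have hi2 : IntegrableOn (fun s => 2 * α⁻¹ * inner ℝ Δ (deriv Z s)) (Ioc 0 1) :=
    (hZi.const_inner Δ).const_mul _
  have hnn : 0 ≤ ∫ s in Ioc (0 : ℝ) 1, (lam * energyDensity (fun x => (W x)⁻¹) (c s, deriv c s)
      - 2 * α⁻¹ * inner ℝ Δ (deriv Z s) + α⁻¹ * ‖Δ‖ ^ 2) := by
    refine integral_nonneg_of_ae ?_
    filter_upwards [ae_mem_Ioo_diff hc.countable] with s hs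
    have hZ' := hP.hasDerivAt_g (hc.hasDerivAt s hs) (hν' s hs)
    -- The test vector `-α⁻¹ Δ` is constant along the path, so that the cross term integrates to `-2
    -- α⁻¹ ‖Δ‖²`; together with `α⁻¹ ‖Δ‖²` from the last block, `-α⁻¹ ‖Δ‖²` remains.
    have h := nonneg_of_lmi₂ (h₂ (c s) (ν s))
      ((W (c s))⁻¹ *ᵥ (deriv c s).ofLp) (-(α⁻¹ • Δ.ofLp))
    have hin : inner ℝ Δ (deriv Z s) = Δ.ofLp ⬝ᵥ (deriv Z s).ofLp := by
      simp [EuclideanSpace.inner_eq_star_dotProduct, dotProduct_comm]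
    rw [hW.energyDensity_inv, hin, hZ'.deriv, norm_sq_eq_dotProduct]
    rw [hW.mulVec_inv_mulVec] at h ⊢
    have hα' : α * (α⁻¹ * (α⁻¹ * (Δ.ofLp ⬝ᵥ Δ.ofLp))) = α⁻¹ * (Δ.ofLp ⬝ᵥ Δ.ofLp) := by
      field_simp
    simp only [neg_dotProduct, dotProduct_neg, smul_dotProduct, dotProduct_smul,
      smul_eq_mul] at h
    simp only [app, Pi.zero_apply, ← Matrix.mulVec_mulVec]
    linarith
  have hi3 : IntegrableOn (fun s => lam * energyDensity (fun x => (W x)⁻¹) (c s, deriv c s)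
      - 2 * α⁻¹ * inner ℝ Δ (deriv Z s)) (Ioc 0 1) := hi1.sub hi2
  rw [integral_add hi3 (integrable_const _), integral_sub hi1 hi2, integral_const_mul,
    integral_const_mul, hint, ← energy_eq, hmin.energy_eq] at hnn
  simp only [integral_const, measureReal_restrict_apply, MeasurableSet.univ, univ_inter,
    Real.volume_real_Ioc, sub_zero, smul_eq_mul, zero_le_one, sup_of_le_left, one_mul] at hnn
  have h3 : α⁻¹ * ‖Δ‖ ^ 2 ≤ lam * minEnergy (fun x => (W x)⁻¹) xs x := by linarith
  rw [inv_mul_le_iff₀ hα] at h3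
  rwa [mul_assoc]

end Feedback

/-! ### Reversal of paths -/

section Reversal

variable {n : ℕ} {M : E n → Matrix (Fin n) (Fin n) ℝ} {a : ℝ} {c : ℝ → E n}

lemma reverse_mem_paths {x y : E n} (hc : c ∈ Paths x y) : (fun s => c (1 - s)) ∈ Paths y x := by
  obtain ⟨h0, h1, N, τ, hτ, ht0, ht1, h⟩ := hc
  refine ⟨by simpa, by simpa, N, fun i => 1 - τ (N - i), fun i j hij => ?_, by simp [ht1],
    by simp [ht0], fun i hi => ?_⟩
  · exact sub_le_sub_left (hτ (by omega)) 1
  · refine (h (N - (i + 1)) (by omega)).comp (g := c) (f := fun s => 1 - s) (by fun_prop) ?_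
    intro s hs
    rw [show N - (i + 1) + 1 = N - i by omega]
    exact ⟨by linarith [hs.2], by linarith [hs.1]⟩

lemma energy_reverse (c : ℝ → E n) : energy M (fun s => c (1 - s)) = energy M c := by
  have h := intervalIntegral.integral_comp_sub_left
    (fun s => form (M (c s)) (deriv c s) (deriv c s)) (a := 0) (b := 1) 1
  simp only [sub_self, sub_zero] at h
  rw [energy, energy, ← h]
  simp only [deriv_comp_const_sub]
  refine intervalIntegral.integral_congr fun s _ => ?_
  simp [form, Matrix.mulVec_neg]

/-- Minimal paths run from target to response, while the offset `β` takes its arguments in the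
opposite order. -/
lemma IsCoerciveMetric.minEnergy_comm (hM : IsCoerciveMetric M a) (x y : E n) :
    minEnergy M x y = minEnergy M y x := by
  have key : ∀ x y : E n, minEnergy M x y ≤ minEnergy M y x := by
    intro x y
    have hne : (Paths y x).Nonempty :=
      ⟨affineField y x, by simpa using mem_paths_of_contDiff (affineField_contDiff y x)⟩
    refine le_csInf (hne.image _) ?_
    rintro _ ⟨c, hc, rfl⟩
    rw [← energy_reverse c]
    exact hM.minEnergy_le (reverse_mem_paths hc)
  exact le_antisymm (key x y) (key y x)

end Reversal

/-- Grönwall's inequality for absolutely continuous functions. -/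
lemma le_add_div_of_deriv_le {φ : ℝ → ℝ} {lam C T : ℝ} (hlam : 0 < lam) (hC : 0 ≤ C) (hT : 0 ≤ T)
    (hφ : AbsolutelyContinuousOnInterval φ 0 T) (hφ0 : 0 ≤ φ 0)
    (hd : ∀ᵐ t, t ∈ Ioc 0 T → ∀ e', HasDerivAt φ e' t → e' ≤ -(lam * φ t) + C) :
    φ T ≤ φ 0 + C / lam := by
  have hexp : AbsolutelyContinuousOnInterval (fun t => Real.exp (lam * t)) 0 T :=
    ContDiffOn.absolutelyContinuousOnInterval (by fun_prop)
  have hconst : AbsolutelyContinuousOnInterval (fun _ : ℝ => C / lam) 0 T :=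
    ContDiffOn.absolutelyContinuousOnInterval (by fun_prop)
  -- The function `exp (lam t) (φ - C / lam)` is absolutely continuous with derivative at most 0
  -- almost everywhere, hence does not increase from `0` to `T`.
  have hf := hexp.fun_mul (hφ.fun_sub hconst)
  have hint := hf.integral_deriv_eq_sub
  have hle : ∫ t in (0 : ℝ)..T, deriv (fun t => Real.exp (lam * t) * (φ t - C / lam)) t ≤ 0 := by
    rw [intervalIntegral.integral_of_le hT]
    refine integral_nonpos_of_ae ?_
    rw [EventuallyLE, ae_restrict_iff' measurableSet_Ioc]
    filter_upwards [hd, hφ.ae_differentiableAt] with t h1 h2 ht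
    have h3 := (h2 (by rw [uIcc_of_le hT]; exact Ioc_subset_Icc_self ht)).hasDerivAt
    have h4 := h1 ht _ h3
    have h5 : HasDerivAt (fun t => Real.exp (lam * t)) (Real.exp (lam * t) * (lam * 1)) t :=
      ((hasDerivAt_id t).const_mul lam).exp
    rw [(h5.fun_mul (h3.sub_const (C / lam))).deriv]
    have h6 : Real.exp (lam * t) * (lam * 1) * (φ t - C / lam) + Real.exp (lam * t) * deriv φ t
        = Real.exp (lam * t) * (lam * φ t - C + deriv φ t) := by
      field_simp
    rw [h6]
    exact mul_nonpos_of_nonneg_of_nonpos (Real.exp_pos _).le (by linarith)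
  rw [hint] at hle
  simp only [mul_zero, Real.exp_zero, one_mul] at hle
  have hE : 1 ≤ Real.exp (lam * T) := Real.one_le_exp (by positivity)
  have hC' : 0 ≤ C / lam := by positivity
  -- Otherwise `φ T - C / lam > φ 0 ≥ 0`, and multiplying by `exp (lam T) ≥ 1` keeps it above `φ 0 -
  -- C / lam`.
  by_contra! hcon
  nlinarith

/-! ### Bounds along closed-loop trajectories -/

section Main

variable {n m p q : ℕ} {P : Plant n m p q} {W : E n → Matrix (Fin n) (Fin n) ℝ}
  {Y : E n → Matrix (Fin m) (Fin n) ℝ} {lam μ α : ℝ}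

/-- The minimal energy between target and response is bounded by its initial value and the size of
the disturbance. -/
lemma minEnergy_le_of_rccmLoop (hP : P.IsC1) (hW : IsUniformlyBoundedMetric W)
    (hY : ∀ i j, Continuous fun x => Y x i j) (hlam : 0 < lam) (hμ : 0 < μ)
    (h₁ : ∀ (x : E n) (u : E m) (w : E p), (-(lmi₁ P W Y lam μ x u w)).PosSemidef)
    {σs σ : Signals n m p} (hσs : P.IsTrajectory σs)
    (hσ : P.IsClosedLoop (rccmLaw (fun x => (W x)⁻¹) fun x => Y x * (W x)⁻¹) σs σ)
    {T wbar : ℝ} (hw : ∀ t ∈ Icc 0 T, ‖σ.w t - σs.w t‖ ≤ wbar) {t : ℝ} (ht : t ∈ Icc 0 T) :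
    minEnergy (fun x => (W x)⁻¹) (σs.x t) (σ.x t)
      ≤ minEnergy (fun x => (W x)⁻¹) (σs.x 0) (σ.x 0) + μ * wbar ^ 2 / lam := by
  obtain ⟨a, hM⟩ := hW.exists_isCoerciveMetric
  rcases ht.1.eq_or_lt with rfl | ht0
  · have : 0 ≤ μ * wbar ^ 2 / lam := by positivity
    linarith
  have hac := hM.absolutelyContinuousOnInterval_minEnergy ht0.le (hσ.1.1 t ht0) (hσs.1 t ht0)
    (fun r hr => by
      obtain ⟨v, ⟨γ, hγ, -⟩, -⟩ := hσ.2 r hr.1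
      exact ⟨γ, hγ⟩)
  refine le_add_div_of_deriv_le hlam (by positivity) ht0.le hac (hM.minEnergy_nonneg _ _) ?_
  have e1 := (ae_restrict_iff' measurableSet_Ici).1 hσ.1.2
  have e2 := (ae_restrict_iff' measurableSet_Ici).1 hσs.2
  filter_upwards [e1, e2] with r h1 h2 hr e' he
  obtain ⟨v, ⟨γ, hγ, hv⟩, hu⟩ := hσ.2 r hr.1.le
  refine (deriv_minEnergy_le hP hW hY h₁ (h1 hr.1.le) (h2 hr.1.le) he hγ (by rw [hu, hv])).trans ?_
  have := hw r ⟨hr.1.le, hr.2.trans ht.2⟩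
  gcongr

/-- The output bound on `[0, T]` for disturbances of amplitude `wbar`. -/
lemma norm_output_sub_sq_le_of_rccmLoop (hP : P.IsC1) (hW : IsUniformlyBoundedMetric W)
    (hY : ∀ i j, Continuous fun x => Y x i j) (hlam : 0 < lam) (hμ : 0 < μ) (hα : 0 < α)
    (h₁ : ∀ (x : E n) (u : E m) (w : E p), (-(lmi₁ P W Y lam μ x u w)).PosSemidef)
    (h₂ : ∀ (x : E n) (u : E m), (lmi₂ P W Y lam μ α x u).PosSemidef)
    {σs σ : Signals n m p} (hσs : P.IsTrajectory σs)
    (hσ : P.IsClosedLoop (rccmLaw (fun x => (W x)⁻¹) fun x => Y x * (W x)⁻¹) σs σ)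
    {T wbar : ℝ} (hw : ∀ t ∈ Icc 0 T, ‖σ.w t - σs.w t‖ ≤ wbar) {t : ℝ} (ht : t ∈ Icc 0 T) :
    ‖P.output σ t - P.output σs t‖ ^ 2
      ≤ α ^ 2 * wbar ^ 2 + α * lam * minEnergy (fun x => (W x)⁻¹) (σ.x 0) (σs.x 0) := by
  obtain ⟨a, hM⟩ := hW.exists_isCoerciveMetric
  rw [hM.minEnergy_comm (σ.x 0)]
  obtain ⟨v, ⟨γ, hγ, hv⟩, hu⟩ := hσ.2 t ht.1
  refine (norm_output_sub_sq_le hP hW hY hα h₂ hγ (by rw [hu, hv])).trans ?_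
  have hαl : 0 < α * lam := mul_pos hα hlam
  -- Without disturbance channels the middle block is empty and says nothing about `μ ≤ α`; but then
  -- `w - w⋆ = 0`, and the energy bound applies with amplitude 0.
  rcases isEmpty_or_nonempty (Fin p) with hp | ⟨⟨i⟩⟩
  · have h := minEnergy_le_of_rccmLoop hP hW hY hlam hμ h₁ hσs hσ (wbar := 0)
      (fun r _ => by simp [EuclideanSpace.norm_eq]) ht
    have := mul_le_mul_of_nonneg_left h hαl.le
    simp only [ne_eq, OfNat.ofNat_ne_zero, not_false_eq_true, zero_pow, mul_zero, zero_div,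
      add_zero] at this
    nlinarith [sq_nonneg (α * wbar)]
  · have hμα := le_of_lmi₂ (h₂ 0 0) i
    have h := minEnergy_le_of_rccmLoop hP hW hY hlam hμ h₁ hσs hσ hw ht
    have h3 := mul_le_mul_of_nonneg_left h hαl.le
    have h4 : α * lam * (μ * wbar ^ 2 / lam) = α * (μ * wbar ^ 2) := by field_simp
    have h5 : α * (μ * wbar ^ 2) ≤ α * (α * wbar ^ 2) := by gcongr
    nlinarith

end Main

end

end RCCM

end

theorem theorem1 {n m p q : ℕ} (P : RCCM.Plant n m p q) (hP : P.IsC1)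
    (W : RCCM.E n → Matrix (Fin n) (Fin n) ℝ) (hW : RCCM.IsUniformlyBoundedMetric W)
    (Y : RCCM.E n → Matrix (Fin m) (Fin n) ℝ) (hY : ∀ i j, Continuous fun x => Y x i j)
    (lam μ α : ℝ) (hlam : 0 < lam) (hμ : 0 < μ) (hα : 0 < α)
    (h₁ : ∀ (x : RCCM.E n) (u : RCCM.E m) (w : RCCM.E p),
      (-(RCCM.lmi₁ P W Y lam μ x u w)).PosSemidef)
    (h₂ : ∀ (x : RCCM.E n) (u : RCCM.E m), (RCCM.lmi₂ P W Y lam μ α x u).PosSemidef) :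
    RCCM.AchievesUniversalLinfGain P (RCCM.rccmLoop P W Y) α
        (fun a b => α * lam * RCCM.minEnergy (fun x => (W x)⁻¹) a b) ∧
      RCCM.CertifiesTubes P (RCCM.rccmLoop P W Y) α := by
  obtain ⟨a, hM⟩ := hW.exists_isCoerciveMetric
  have hβ : ∀ x y, 0 ≤ α * lam * RCCM.minEnergy (fun x => (W x)⁻¹) x y := fun x y =>
    mul_nonneg (mul_pos hα hlam).le (hM.minEnergy_nonneg x y)
  refine ⟨⟨hβ, fun x => by simp only [RCCM.minEnergy_self hM, mul_zero], ?_⟩, ?_⟩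
  · intro σs σ hσs hσ hw T hT
    have hfin : RCCM.truncNorm T (fun t => σ.w t - σs.w t) ≠ ⊤ := (hw 0 T le_rfl).ne
    -- The supremum is finite since `w - w⋆` is in `L∞e`, so the estimate can be made in real
    -- numbers and carried back.
    set wbar := (RCCM.truncNorm T fun t => σ.w t - σs.w t).toReal with hwbar
    have hwle : ∀ t ∈ Set.Icc 0 T, ‖σ.w t - σs.w t‖ ≤ wbar := by
      intro t ht
      rw [hwbar, ← toReal_enorm]
      exact ENNReal.toReal_mono hfin (le_iSup₂ (f := fun t _ => ‖σ.w t - σs.w t‖ₑ) t ht)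
    set β := α * lam * RCCM.minEnergy (fun x => (W x)⁻¹) (σ.x 0) (σs.x 0) with hβdef
    have hβ0 : 0 ≤ β := hβ _ _
    have hz : RCCM.truncNorm T (fun t => P.output σ t - P.output σs t)
        ≤ ENNReal.ofReal (√(α ^ 2 * wbar ^ 2 + β)) := by
      refine iSup₂_le fun t ht => ?_
      rw [← ofReal_norm]
      refine ENNReal.ofReal_le_ofReal (Real.le_sqrt_of_sq_le ?_)
      exact RCCM.norm_output_sub_sq_le_of_rccmLoop hP hW hY hlam hμ hα h₁ h₂ hσs hσ.1 hwle ht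
    calc RCCM.truncNorm T (fun t => P.output σ t - P.output σs t) ^ 2
        ≤ ENNReal.ofReal (√(α ^ 2 * wbar ^ 2 + β)) ^ 2 := by gcongr
      _ = ENNReal.ofReal α ^ 2 * RCCM.truncNorm T (fun t => σ.w t - σs.w t) ^ 2
            + ENNReal.ofReal β := by
          rw [← ENNReal.ofReal_pow (Real.sqrt_nonneg _), Real.sq_sqrt (by positivity),
            ENNReal.ofReal_add (by positivity) hβ0, ENNReal.ofReal_mul (by positivity),
            ENNReal.ofReal_pow hα.le, ENNReal.ofReal_pow (by positivity), hwbar,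
            ENNReal.ofReal_toReal hfin]
  · intro σs σ hσs hσ _ hx T hT wbar hw t ht
    have h := RCCM.norm_output_sub_sq_le_of_rccmLoop hP hW hY hlam hμ hα h₁ h₂ hσs hσ.1 hw ht
    rw [hx, RCCM.minEnergy_self hM, mul_zero, add_zero, ← mul_pow] at h
    have hw0 : 0 ≤ wbar := (norm_nonneg _).trans (hw t ht)
    exact le_of_sq_le_sq h (by positivity)
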